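/- Let $d\ge 1$. For constants $m>0$, $M$, $L$, $C_S$ and a bounded set $S\subset\mathbb R^d$, let $\Sigma_A(S)$ be the set of probability densities $f$ on $\mathbb R^d$ such that $f=0$ outside $S$, $m\le f(x)\le M$ for all $x\in S$, $|f(x)-f(y)|\le L\|x-y\|$ for all $x,y\in S$, and such that the surface area of $S$, i.e. the $(d-1)$-dimensional Hausdorff measure of $\partial S$, is at most $C_S$. Given i.i.d. samples $X_1,\dots,X_N$ with density $f$ and $2\le k\le N$, let $\rho(x)$ be the distance from $x$ to its $k$-th nearest neighbour among $X_1,\dots,X_N$, and let $$\hat f_{k}(x)=\frac{k-1}{N\,V(B(x,\rho(x)))}$$ be the kNN density estimator, where $V$ is the volume and $B(x,\rho)$ the Euclidean ball. Write $\|\hat f-f\|_1=\int_S|\hat f(x)-f(x)|\,dx$. 1. There is a constant $C$ depending only on $d,m,M,L,C_S$ such that for every bounded set $S$, every $f\in\Sigma_A(S)$ and all $2\le k\le N$, $$\mathbb E\,\|\hat f_{k}-f\|_1\le C\left(\left(\frac kN\right)^{1/d}+k^{-1/2}\right).$$ 2. Let $S$ be a bounded set of positive volume whose surface area is at most $C_S$.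 There are $L_0$, $M_0$, $m_0>0$ and $c>0$ such that for all $L\ge L_0$, $M\ge M_0$, $0<m\le m_0$ and all $N\ge1$, $$\inf_{\hat f}\ \sup_{f\in\Sigma_A(S)}\mathbb E\,\|\hat f-f\|_1\ \ge\ c\,N^{-\frac1{d+2}},$$ where the infimum is over all estimators based on $X_1,\dots,X_N$ (which may depend on $S$ and the constants). 3. Consequently, in the situation of 2, kNN with $k\sim N^{2/(d+2)}$ is minimax rate optimal: for all $0<a\le b$ there is a constant $C$ such that, whenever $2\le k\le N$ and $aN^{2/(d+2)}\le k\le bN^{2/(d+2)}$, $$\sup_{f\in\Sigma_A(S)}\mathbb E\,\|\hat f_{k}-f\|_1\le C N^{-\frac1{d+2}}\quad\text{and}\quad \sup_{f\in\Sigma_A(S)}\mathbb E\,\|\hat f_{k}-f\|_1\le C\inf_{\hat f}\ \sup_{f\in\Sigma_A(S)}\mathbb E\,\|\hat f-f\|_1 .$$ -/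

import Mathlib

open MeasureTheory Set
open scoped ENNReal NNReal

noncomputable section

/-- `f` is a probability density on `ℝ^d` with bounded support set `S`: it vanishes off `S`,
satisfies `m ≤ f ≤ M` on `S`, is `L`-Lipschitz on `S` (for the Euclidean distance), and the
boundary of `S` has `(d-1)`-dimensional Hausdorff measure at most `CS`. -/
structure IsBoundedSupportDensity (d : ℕ) (m M L : ℝ) (CS : ℝ≥0)
    (S : Set (EuclideanSpace ℝ (Fin d))) (f : EuclideanSpace ℝ (Fin d) → ℝ) : Prop where
  isBounded : Bornology.IsBounded S
  measurable : Measurable f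
  eq_zero_of_notMem : ∀ x ∉ S, f x = 0
  lintegral_eq_one : ∫⁻ x, ENNReal.ofReal (f x) = 1
  lower_bound : ∀ x ∈ S, m ≤ f x
  upper_bound : ∀ x ∈ S, f x ≤ M
  lipschitz : ∀ x ∈ S, ∀ y ∈ S, |f x - f y| ≤ L * ‖x - y‖
  surface_area : μH[(d : ℝ) - 1] (frontier S) ≤ (CS : ℝ≥0∞)

/-- The distance from `x` to its `k`-th nearest neighbour among `X 0, …, X (N-1)`: the least
radius whose closed ball around `x` contains at least `k` of the samples. -/
def knnDist {d N : ℕ} (k : ℕ) (X : Fin N → EuclideanSpace ℝ (Fin d))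
    (x : EuclideanSpace ℝ (Fin d)) : ℝ :=
  sInf {r : ℝ | 0 ≤ r ∧ k ≤ (Finset.univ.filter fun i => dist (X i) x ≤ r).card}

/-- The plain kNN density estimator `(k - 1) / (N V(B(x, ρ(x))))`. -/
def knnEstimator {d : ℕ} (N k : ℕ) (X : Fin N → EuclideanSpace ℝ (Fin d))
    (x : EuclideanSpace ℝ (Fin d)) : ℝ :=
  ((k : ℝ) - 1) / (N * (volume (Metric.closedBall x (knnDist k X x))).toReal)

/-- The expected `ℓ₁` error `E ∫_S |f̂ - f|` of an estimator `est` of `f`, when the `N` samples are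
independent with density `f`. -/
def l1Risk {d : ℕ} (N : ℕ) (S : Set (EuclideanSpace ℝ (Fin d)))
    (f : EuclideanSpace ℝ (Fin d) → ℝ)
    (est : (Fin N → EuclideanSpace ℝ (Fin d)) → EuclideanSpace ℝ (Fin d) → ℝ) : ℝ≥0∞ :=
  ∫⁻ X, (∫⁻ x in S, ‖est X x - f x‖ₑ)
    ∂(Measure.pi fun _ : Fin N => volume.withDensity fun x => ENNReal.ofReal (f x))

/-- The supremum of the `ℓ₁` risk of `est` over all densities in the class with the fixed
support `S`. -/
def worstRisk {d : ℕ} (m M L : ℝ) (CS : ℝ≥0) (S : Set (EuclideanSpace ℝ (Fin d))) (N : ℕ)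
    (est : (Fin N → EuclideanSpace ℝ (Fin d)) → EuclideanSpace ℝ (Fin d) → ℝ) : ℝ≥0∞ :=
  ⨆ (f : EuclideanSpace ℝ (Fin d) → ℝ) (_ : IsBoundedSupportDensity d m M L CS S f),
    l1Risk N S f est

/-- The minimax `ℓ₁` risk over the class with known support `S`. The infimum is over all
(jointly measurable) estimators; they may depend on `S` and on all the parameters. -/
def minimaxRisk {d : ℕ} (m M L : ℝ) (CS : ℝ≥0) (S : Set (EuclideanSpace ℝ (Fin d))) (N : ℕ) :
    ℝ≥0∞ :=
  ⨅ (est : (Fin N → EuclideanSpace ℝ (Fin d)) → EuclideanSpace ℝ (Fin d) → ℝ)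
    (_ : Measurable (Function.uncurry est)), worstRisk m M L CS S N est

end

/-! Upper bound. Let `p` and `V` be the probability and the volume of the nearest-neighbour ball of
radius `ρ` at `x`, and `Z = (k - 1) / (N p)` (`knnRatio`). The estimator is `Z * p / V`, so its
error is at most `M |Z - 1|` plus the bias `|p / V - f x|`. The moments of `Z` come from a
leave-one-out argument instead of the Beta law of `p`: deleting one of the `k` nearest samples turns
the `(k + 1)`-st distance among `N + 1` samples into the `k`-th distance among the other `N`. By
exchangeability this gives `k E φ(ρ_{k+1,N+1}) = (N + 1) E [p φ(ρ_{k,N})]` when spheres are null.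
With `φ = 1/p` and `φ = 1/p²` one gets `E Z = 1` and `E (Z - 1)² ≤ 1 / (k - 2)` for `k ≥ 3`, hence
`E |Z - 1|` of order `k ^ (-1/2)`. For the bias, fix `r` of order `(k/N) ^ (1/d)`. If `ρ ≤ r`, the
Lipschitz condition leaves `L r` and the part of the ball outside `S`. If `ρ > r`, then either `Z ≤
1/2`, or at least half of the ball of radius `r` lies outside `S`. The volume outside `S` is small
on average over `x ∈ S`: by Fubini it is an integral over `‖h‖ ≤ r` of the volume of `{x ∈ S | x + h
∉ S}`. A segment leaving `S` meets the frontier, so this set lies in the sweep of the frontier along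
`h`, of volume at most a constant times `‖h‖` times the surface area (`volume_sweep_le`).

Lower bound. This is Assouad's method. A ball inside `S` holds `2 n ^ d` disjoint tents of height
and radius `r ~ 1/n`, used to perturb the uniform density in pairs of opposite signs, so that mass
is kept. Flipping one pair lowers the affinity `∫ √(p q)` by order `r ^ (d + 2)` at most; with `n ~
N ^ (1/(d+2))` the two `N`-sample laws still overlap, so each pair costs risk of order `r * r ^ d`.
The `n ^ d` pairs add up to order `r`.

Optimality follows since `k ~ N ^ (2/(d+2))` gives both terms of the upper bound the order `N ^
(-1/(d+2))`. -/

/-- The points that are moved into `A` by some translation along the segment from `0` to `h`. -/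
def sweep {E : Type*} [AddCommGroup E] [Module ℝ E] (h : E) (A : Set E) : Set E :=
  {x | ∃ t ∈ Icc (0 : ℝ) 1, x + t • h ∈ A}

lemma sweep_mono {E : Type*} [AddCommGroup E] [Module ℝ E] (h : E) {A B : Set E} (hAB : A ⊆ B) :
    sweep h A ⊆ sweep h B :=
  fun _ ⟨t, ht, hx⟩ => ⟨t, ht, hAB hx⟩

lemma subset_sweep {E : Type*} [AddCommGroup E] [Module ℝ E] (h : E) (A : Set E) :
    A ⊆ sweep h A :=
  fun x hx => ⟨0, by simp, by simpa using hx⟩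

lemma sweep_iUnion {E ι : Type*} [AddCommGroup E] [Module ℝ E] (h : E) (A : ι → Set E) :
    sweep h (⋃ i, A i) ⊆ ⋃ i, sweep h (A i) := by
  rintro x ⟨t, ht, hx⟩
  obtain ⟨i, hi⟩ := mem_iUnion.1 hx
  exact mem_iUnion.2 ⟨i, t, ht, hi⟩

/-! ### Swept volumes, Hausdorff measure of the frontier, and balls leaving `S`. -/

section Geometry

variable {d : ℕ}

/-- The volume of the Euclidean unit ball. -/
noncomputable def unitBallVolume (d : ℕ) : ℝ :=
  (volume (Metric.closedBall (0 : EuclideanSpace ℝ (Fin d)) 1)).toReal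

lemma unitBallVolume_pos (d : ℕ) : 0 < unitBallVolume d :=
  ENNReal.toReal_pos (Metric.measure_closedBall_pos volume _ one_pos).ne'
    measure_closedBall_lt_top.ne

lemma volume_closedBall_eq (x : EuclideanSpace ℝ (Fin d)) {r : ℝ} (hr : 0 ≤ r) :
    volume (Metric.closedBall x r) = ENNReal.ofReal (unitBallVolume d * r ^ d) := by
  rw [Measure.addHaar_closedBall' _ _ hr, ENNReal.ofReal_mul (unitBallVolume_pos d).le,
    unitBallVolume, ENNReal.ofReal_toReal measure_closedBall_lt_top.ne, mul_comm]
  simp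

/-- Rounding `t` down to a multiple of `1 / n`, with `n = ⌈‖h‖ / δ⌉₊`, moves the point by at most
`‖h‖ / n ≤ δ`; doubling the radius absorbs this. -/
lemma sweep_closedBall_subset (a h : EuclideanSpace ℝ (Fin d)) {δ : ℝ} (hδ : 0 < δ)
    (hh : h ≠ 0) :
    sweep h (Metric.closedBall a δ) ⊆
      ⋃ i ∈ Finset.range (⌈‖h‖ / δ⌉₊ + 1),
        Metric.closedBall (a - ((i : ℝ) / ⌈‖h‖ / δ⌉₊) • h) (2 * δ) := by
  have hpos : 0 < ‖h‖ := norm_pos_iff.2 hh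
  set n := ⌈‖h‖ / δ⌉₊ with hn
  have hn0 : 0 < n := Nat.ceil_pos.2 (by positivity)
  have hn1 : ‖h‖ / δ ≤ n := Nat.le_ceil _
  have hnR : (0 : ℝ) < n := by exact_mod_cast hn0
  rintro x ⟨t, ⟨ht0, ht1⟩, hx⟩
  have h1 : (⌊t * n⌋₊ : ℝ) ≤ t * n := Nat.floor_le (by positivity)
  have h2 : t * n < ⌊t * n⌋₊ + 1 := Nat.lt_floor_add_one _
  refine mem_iUnion₂.2 ⟨⌊t * n⌋₊, ?_, ?_⟩
  · rw [Finset.mem_range, Nat.lt_succ_iff]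
    have : (⌊t * n⌋₊ : ℝ) ≤ n := h1.trans (by nlinarith)
    exact_mod_cast this
  · rw [Metric.mem_closedBall, dist_eq_norm] at hx ⊢
    have e : x - (a - ((⌊t * n⌋₊ : ℝ) / n) • h)
        = (x + t • h - a) - (t - (⌊t * n⌋₊ : ℝ) / n) • h := by
      rw [sub_smul]; abel
    have h3 : |t - (⌊t * n⌋₊ : ℝ) / n| ≤ 1 / n := by
      have : t - (⌊t * n⌋₊ : ℝ) / n = (t * n - ⌊t * n⌋₊) / n := by field_simp
      rw [this, abs_div, abs_of_pos hnR]
      gcongr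
      rw [abs_le]; constructor <;> linarith
    have h4 : 1 / (n : ℝ) * ‖h‖ ≤ δ := by
      rw [div_le_iff₀ hδ] at hn1
      rw [one_div_mul_eq_div, div_le_iff₀ hnR]; linarith
    rw [e]
    calc _ ≤ ‖x + t • h - a‖ + ‖(t - (⌊t * n⌋₊ : ℝ) / n) • h‖ := norm_sub_le _ _
      _ ≤ δ + 1 / n * ‖h‖ := by
          rw [norm_smul, Real.norm_eq_abs]; gcongr
      _ ≤ 2 * δ := by linarith

/-- The dimensional constant in the bound of the volume of a swept set. -/
noncomputable def sweepConst (d : ℕ) : ℝ := 6 * unitBallVolume d * 2 ^ d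

lemma sweepConst_pos (d : ℕ) : 0 < sweepConst d := by
  have := unitBallVolume_pos d
  unfold sweepConst; positivity

/-- About `‖h‖ / δ` balls of volume of order `δ ^ d` cover the sweep, which trades one power of `δ`
for `‖h‖`. The hypothesis `δ ≤ 2 * ‖h‖` absorbs the rounding terms in the number of balls. -/
lemma volume_sweep_closedBall_le (hd : 1 ≤ d) (a h : EuclideanSpace ℝ (Fin d)) {δ : ℝ}
    (hδ : 0 < δ) (hδh : δ ≤ 2 * ‖h‖) :
    volume (sweep h (Metric.closedBall a δ)) ≤
      ENNReal.ofReal (sweepConst d * ‖h‖ * δ ^ (d - 1)) := by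
  have hpos : 0 < ‖h‖ := by linarith
  have hh : h ≠ 0 := norm_pos_iff.1 hpos
  have hκ := unitBallVolume_pos d
  calc volume (sweep h (Metric.closedBall a δ))
      ≤ ∑ i ∈ Finset.range (⌈‖h‖ / δ⌉₊ + 1),
        volume (Metric.closedBall (a - ((i : ℝ) / ⌈‖h‖ / δ⌉₊) • h) (2 * δ)) :=
        (measure_mono (sweep_closedBall_subset a h hδ hh)).trans (measure_biUnion_finset_le _ _)
    _ = ENNReal.ofReal ((⌈‖h‖ / δ⌉₊ + 1) * (unitBallVolume d * (2 * δ) ^ d)) := by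
        simp_rw [volume_closedBall_eq _ (by positivity : 0 ≤ 2 * δ)]
        rw [Finset.sum_const, Finset.card_range, nsmul_eq_mul, ENNReal.ofReal_mul (by positivity)]
        rw [← Nat.cast_add_one, ENNReal.ofReal_mul (p := ((⌈‖h‖ / δ⌉₊ + 1 : ℕ) : ℝ)) (by positivity),
          ENNReal.ofReal_natCast, ENNReal.ofReal_mul (by positivity)]
    _ ≤ _ := by
        apply ENNReal.ofReal_le_ofReal
        have h1 : (⌈‖h‖ / δ⌉₊ : ℝ) < ‖h‖ / δ + 1 := Nat.ceil_lt_add_one (by positivity)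
        obtain ⟨e, rfl⟩ : ∃ e, d = e + 1 := ⟨d - 1, by omega⟩
        have h2 : ((⌈‖h‖ / δ⌉₊ : ℝ) + 1) * δ ≤ 6 * ‖h‖ := by
          have : (‖h‖ / δ + 2) * δ = ‖h‖ + 2 * δ := by field_simp
          nlinarith
        simp only [sweepConst, Nat.add_sub_cancel]
        calc _ = ((⌈‖h‖ / δ⌉₊ + 1) * δ) * (unitBallVolume (e + 1) * 2 ^ (e + 1) * δ ^ e) := by ring
          _ ≤ (6 * ‖h‖) * (unitBallVolume (e + 1) * 2 ^ (e + 1) * δ ^ e) := by gcongr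
          _ = _ := by ring

/-- The right side has the form of a term in the covering formula for Hausdorff measure. The
diameter may be zero, so `U` is enclosed in balls of radius `δ` above the diameter and `δ` tends
down to it. -/
lemma volume_sweep_le_ediam (hd : 1 ≤ d) (h : EuclideanSpace ℝ (Fin d)) (hh : h ≠ 0)
    (U : Set (EuclideanSpace ℝ (Fin d))) (hU : Metric.ediam U ≤ ENNReal.ofReal ‖h‖) :
    volume (sweep h U) ≤ ENNReal.ofReal (sweepConst d * ‖h‖) *
      ⨆ _ : U.Nonempty, Metric.ediam U ^ ((d : ℝ) - 1) := by
  rcases U.eq_empty_or_nonempty with rfl | hne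
  · simp [sweep]
  have hpos : 0 < ‖h‖ := norm_pos_iff.2 hh
  have hfin : Metric.ediam U ≠ ⊤ := ne_top_of_le_ne_top ENNReal.ofReal_ne_top hU
  obtain ⟨a, ha⟩ := hne
  set D := (Metric.ediam U).toReal with hD
  have hD0 : 0 ≤ D := ENNReal.toReal_nonneg
  have hDh : D ≤ ‖h‖ := ENNReal.toReal_le_of_le_ofReal hpos.le hU
  have hC := sweepConst_pos d
  have key : ∀ δ ∈ Ioc D (2 * ‖h‖), volume (sweep h U) ≤
      ENNReal.ofReal (sweepConst d * ‖h‖ * δ ^ (d - 1)) := by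
    intro δ hδ
    refine (measure_mono (sweep_mono h ?_)).trans
      (volume_sweep_closedBall_le hd a h (hD0.trans_lt hδ.1) hδ.2)
    intro x hx
    rw [Metric.mem_closedBall, dist_edist]
    refine le_trans ?_ hδ.1.le
    exact ENNReal.toReal_mono hfin (Metric.edist_le_ediam_of_mem hx ha)
  have lim : Filter.Tendsto (fun δ : ℝ => ENNReal.ofReal (sweepConst d * ‖h‖ * δ ^ (d - 1)))
      (nhdsWithin D (Ioi D)) (nhds (ENNReal.ofReal (sweepConst d * ‖h‖ * D ^ (d - 1)))) := by
    have : Continuous (fun δ : ℝ => ENNReal.ofReal (sweepConst d * ‖h‖ * δ ^ (d - 1))) :=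
      ENNReal.continuous_ofReal.comp (by fun_prop)
    exact this.continuousWithinAt
  have := ge_of_tendsto lim (Filter.mem_of_superset
    (Ioc_mem_nhdsGT (show D < 2 * ‖h‖ by linarith)) key)
  refine this.trans (le_of_eq ?_)
  rw [ENNReal.ofReal_mul (by positivity), ciSup_pos ⟨a, ha⟩, ENNReal.ofReal_pow hD0, hD,
    ENNReal.ofReal_toReal hfin, ← ENNReal.rpow_natCast, Nat.cast_sub hd, Nat.cast_one]

/-- Sweeping a set along a segment of length `‖h‖` yields a volume of at most a constant times
`‖h‖` times the `(d - 1)`-dimensional Hausdorff measure of the set. -/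
theorem volume_sweep_le (hd : 1 ≤ d) (h : EuclideanSpace ℝ (Fin d)) (hh : h ≠ 0)
    (A : Set (EuclideanSpace ℝ (Fin d))) :
    volume (sweep h A) ≤ ENNReal.ofReal (sweepConst d * ‖h‖) * μH[(d : ℝ) - 1] A := by
  have hpos : 0 < ‖h‖ := norm_pos_iff.2 hh
  have hC := sweepConst_pos d
  have hc0 : ENNReal.ofReal (sweepConst d * ‖h‖) ≠ 0 := by
    rw [Ne, ENNReal.ofReal_eq_zero, not_le]; positivity
  rw [mul_comm, ← ENNReal.div_le_iff_le_mul (Or.inl hc0) (Or.inl ENNReal.ofReal_ne_top),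
    Measure.hausdorffMeasure_apply]
  -- The scale `‖h‖` suffices: covers by pieces of diameter at most `‖h‖` are those to which
  -- `volume_sweep_le_ediam` applies.
  refine le_trans ?_ (le_iSup₂ (ENNReal.ofReal ‖h‖) (ENNReal.ofReal_pos.2 hpos))
  refine le_iInf fun t => le_iInf fun hA => le_iInf fun ht => ?_
  rw [ENNReal.div_le_iff_le_mul (Or.inl hc0) (Or.inl ENNReal.ofReal_ne_top), mul_comm,
    ← ENNReal.tsum_mul_left]
  calc volume (sweep h A) ≤ volume (⋃ n, sweep h (t n)) :=
        measure_mono ((sweep_mono h hA).trans (sweep_iUnion h t))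
    _ ≤ ∑' n, volume (sweep h (t n)) := measure_iUnion_le _
    _ ≤ _ := ENNReal.tsum_le_tsum fun n => volume_sweep_le_ediam hd h hh _ (ht n)

/-- The segment from `x` to `x + h` is connected. If it missed the frontier, the interior of `S` and
the complement of its closure would separate its endpoints. -/
lemma diff_translate_subset_sweep (S : Set (EuclideanSpace ℝ (Fin d)))
    (h : EuclideanSpace ℝ (Fin d)) :
    {x | x ∈ S ∧ x + h ∉ S} ⊆ sweep h (frontier S) := by
  rintro x ⟨hx, hxh⟩
  have hc : IsPreconnected ((fun t : ℝ => x + t • h) '' Icc 0 1) :=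
    isPreconnected_Icc.image _ (by fun_prop)
  by_contra hcon
  have hnf : ∀ y ∈ (fun t : ℝ => x + t • h) '' Icc 0 1, y ∉ frontier S := by
    rintro _ ⟨t, ht, rfl⟩ hf
    exact hcon ⟨t, ht, hf⟩
  have hx0 : x ∈ (fun t : ℝ => x + t • h) '' Icc 0 1 := ⟨0, by simp, by simp⟩
  have hx1 : x + h ∈ (fun t : ℝ => x + t • h) '' Icc 0 1 := ⟨1, by simp, by simp⟩
  have mem_int : ∀ y ∈ (fun t : ℝ => x + t • h) '' Icc 0 1, y ∈ closure S → y ∈ interior S :=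
    fun y hy hyc => by_contra fun hyi => hnf y hy ⟨hyc, hyi⟩
  obtain ⟨y, -, hyi, hyc⟩ := hc (interior S) (closure S)ᶜ isOpen_interior
    isClosed_closure.isOpen_compl
    (fun y hy => (em (y ∈ closure S)).imp (mem_int y hy) id)
    ⟨x, hx0, mem_int x hx0 (subset_closure hx)⟩
    ⟨x + h, hx1, fun hc' => hxh (interior_subset (mem_int _ hx1 hc'))⟩
  exact hyc (interior_subset_closure hyi)

lemma volume_diff_translate_le (hd : 1 ≤ d) (S : Set (EuclideanSpace ℝ (Fin d))) {CS : ℝ≥0}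
    (hS : μH[(d : ℝ) - 1] (frontier S) ≤ (CS : ℝ≥0∞)) (h : EuclideanSpace ℝ (Fin d)) :
    volume {x | x ∈ S ∧ x + h ∉ S} ≤ ENNReal.ofReal (sweepConst d * CS * ‖h‖) := by
  rcases eq_or_ne h 0 with rfl | hh
  · simp
  have hC := sweepConst_pos d
  calc _ ≤ ENNReal.ofReal (sweepConst d * ‖h‖) * μH[(d : ℝ) - 1] (frontier S) :=
        (measure_mono (diff_translate_subset_sweep S h)).trans (volume_sweep_le hd h hh _)
    _ ≤ ENNReal.ofReal (sweepConst d * ‖h‖) * CS := by gcongr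
    _ = _ := by
        rw [← ENNReal.ofReal_coe_nnreal, ← ENNReal.ofReal_mul (by positivity)]
        congr 1; ring

/-- On average over `S`, a ball of radius `r` loses at most a fraction of order `r` outside `S`. -/
theorem lintegral_volume_closedBall_diff_le (hd : 1 ≤ d) {S : Set (EuclideanSpace ℝ (Fin d))}
    (hSm : MeasurableSet S) {CS : ℝ≥0}
    (hS : μH[(d : ℝ) - 1] (frontier S) ≤ (CS : ℝ≥0∞)) {r : ℝ} (hr : 0 ≤ r) :
    ∫⁻ x in S, volume (Metric.closedBall x r \ S) ≤
      ENNReal.ofReal (unitBallVolume d * r ^ d * (sweepConst d * CS * r)) := by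
  have hC := sweepConst_pos d
  have hκ := unitBallVolume_pos d
  let E := EuclideanSpace ℝ (Fin d)
  -- Pairs of a point of `S` and a displacement of length at most `r` leading out of `S`; slicing
  -- `T` in the other variable fixes the displacement.
  let T : Set (E × E) := {q | q.1 ∈ S ∧ q.1 + q.2 ∉ S ∧ q.2 ∈ Metric.closedBall (0 : E) r}
  have hT : MeasurableSet T := by
    apply (measurable_fst hSm).inter
    exact ((measurable_fst.add measurable_snd) hSm.compl).inter
      (measurable_snd Metric.isClosed_closedBall.measurableSet)
  have e1 : ∫⁻ x in S, volume (Metric.closedBall x r \ S) = (volume.prod volume) T := by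
    rw [Measure.prod_apply hT, ← lintegral_indicator hSm]
    congr 1 with x
    by_cases hx : x ∈ S
    · rw [indicator_of_mem hx, ← measure_preimage_add volume x]
      congr 1 with y
      simp only [mem_preimage, mem_sdiff, Metric.mem_closedBall, dist_self_add_left, T, mem_ofPred_eq,
        hx, true_and, dist_zero_right]
      tauto
    · rw [indicator_of_notMem hx]
      have : Prod.mk x ⁻¹' T = ∅ := by ext y; exact ⟨fun hy => hx hy.1, fun hy => hy.elim⟩
      simp [this]
  rw [e1, Measure.prod_apply_symm hT]
  calc ∫⁻ y, volume ((fun x => (x, y)) ⁻¹' T)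
      ≤ ∫⁻ y, (Metric.closedBall (0 : E) r).indicator
          (fun _ => ENNReal.ofReal (sweepConst d * CS * r)) y := by
        refine lintegral_mono fun y => ?_
        by_cases hy : y ∈ Metric.closedBall (0 : E) r
        · rw [indicator_of_mem hy]
          refine (measure_mono ?_).trans ((volume_diff_translate_le hd S hS y).trans ?_)
          · rintro x ⟨h1, h2, -⟩
            exact ⟨h1, h2⟩
          · rw [mem_closedBall_zero_iff] at hy
            gcongr
        · have : (fun x => (x, y)) ⁻¹' T = ∅ := by
            ext x
            simp only [T, mem_preimage, mem_ofPred_eq, mem_empty_iff_false, iff_false]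
            tauto
          simp [this]
    _ = _ := by
        rw [lintegral_indicator Metric.isClosed_closedBall.measurableSet, setLIntegral_const,
          volume_closedBall_eq _ hr, ← ENNReal.ofReal_mul (by positivity), mul_comm]

/-- The frontier is contained in its own sweep along arbitrarily short segments, whose volume is of
the order of their length. -/
lemma volume_frontier_eq_zero (hd : 1 ≤ d) {S : Set (EuclideanSpace ℝ (Fin d))} {CS : ℝ≥0}
    (hS : μH[(d : ℝ) - 1] (frontier S) ≤ (CS : ℝ≥0∞)) : volume (frontier S) = 0 := by
  have hC := sweepConst_pos d
  obtain ⟨e, he⟩ : ∃ e : EuclideanSpace ℝ (Fin d), ‖e‖ = 1 :=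
    ⟨EuclideanSpace.single ⟨0, hd⟩ 1, by simp⟩
  have key : ∀ t ∈ Ioc (0 : ℝ) 1, volume (frontier S) ≤
      ENNReal.ofReal (sweepConst d * t) * CS := by
    intro t ht
    have hn : ‖t • e‖ = t := by rw [norm_smul, he, mul_one, Real.norm_of_nonneg ht.1.le]
    have h0 : t • e ≠ 0 := by rw [← norm_pos_iff, hn]; exact ht.1
    have := (measure_mono (subset_sweep (t • e) (frontier S))).trans
      (volume_sweep_le hd (t • e) h0 _)
    rw [hn] at this
    exact this.trans (by gcongr)
  have lim : Filter.Tendsto (fun t : ℝ => ENNReal.ofReal (sweepConst d * t) * (CS : ℝ≥0∞))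
      (nhdsWithin 0 (Ioi 0)) (nhds (ENNReal.ofReal (sweepConst d * 0) * CS)) := by
    refine ENNReal.Tendsto.mul_const ?_ (Or.inr ENNReal.coe_ne_top)
    have : Continuous (fun t : ℝ => ENNReal.ofReal (sweepConst d * t)) :=
      ENNReal.continuous_ofReal.comp (by fun_prop)
    exact this.continuousWithinAt
  have := ge_of_tendsto lim (Filter.mem_of_superset (Ioc_mem_nhdsGT one_pos) key)
  simpa using this

/-- Provides room for the ball in which the perturbations of the lower bound are placed. -/
lemma interior_nonempty_of_frontier (hd : 1 ≤ d) {S : Set (EuclideanSpace ℝ (Fin d))}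
    {CS : ℝ≥0} (hS : μH[(d : ℝ) - 1] (frontier S) ≤ (CS : ℝ≥0∞)) (hpos : 0 < volume S) :
    (interior S).Nonempty := by
  by_contra hne
  rw [not_nonempty_iff_eq_empty] at hne
  have : S ⊆ frontier S := by
    rw [frontier, hne, sdiff_empty]; exact subset_closure
  exact hpos.ne' (measure_mono_null this (volume_frontier_eq_zero hd hS))

end Geometry

/-! ### Nearest-neighbour distances and the leave-one-out comparison. -/

section OrderStatistic

variable {d N : ℕ}

lemma knnDist_mem {k : ℕ} (hk : k ≤ N) (X : Fin N → EuclideanSpace ℝ (Fin d))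
    (x : EuclideanSpace ℝ (Fin d)) :
    0 ≤ knnDist k X x ∧
      k ≤ (Finset.univ.filter fun i => dist (X i) x ≤ knnDist k X x).card := by
  set A : Set ℝ := {r : ℝ | 0 ≤ r ∧ k ≤ (Finset.univ.filter fun i => dist (X i) x ≤ r).card}
    with hA
  have hcl : IsClosed A := by
    -- A finite union over the possible sets of captured samples, each contributing closed
    -- conditions on `r`; so the infimum is attained.
    have : A = ⋃ T : {T : Finset (Fin N) // k ≤ T.card},
        Ici (0 : ℝ) ∩ ⋂ i ∈ T.1, Ici (dist (X i) x) := by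
      ext r
      simp only [mem_iUnion, mem_inter_iff, mem_Ici, mem_iInter]
      constructor
      · rintro ⟨h0, h1⟩
        exact ⟨⟨_, h1⟩, h0, fun i hi => (Finset.mem_filter.1 hi).2⟩
      · rintro ⟨⟨T, hT⟩, h0, h1⟩
        exact ⟨h0, hT.trans (Finset.card_le_card fun i hi => by simpa using h1 i hi)⟩
    rw [this]
    refine isClosed_iUnion_of_finite fun T => isClosed_Ici.inter ?_
    exact isClosed_biInter fun i _ => isClosed_Ici
  have hne : A.Nonempty := by
    refine ⟨∑ i, dist (X i) x, by positivity, ?_⟩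
    rw [Finset.filter_true_of_mem]
    · simpa using hk
    · intro i _
      exact Finset.single_le_sum (f := fun i => dist (X i) x) (fun _ _ => dist_nonneg)
        (Finset.mem_univ i)
  exact hcl.csInf_mem hne ⟨0, fun r hr => hr.1⟩

lemma knnDist_nonneg {k : ℕ} (X : Fin N → EuclideanSpace ℝ (Fin d))
    (x : EuclideanSpace ℝ (Fin d)) : 0 ≤ knnDist k X x :=
  Real.sInf_nonneg fun _ hr => hr.1

lemma knnDist_le_iff {k : ℕ} (hk1 : 1 ≤ k) (hk : k ≤ N) (X : Fin N → EuclideanSpace ℝ (Fin d))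
    (x : EuclideanSpace ℝ (Fin d)) (r : ℝ) :
    knnDist k X x ≤ r ↔ k ≤ (Finset.univ.filter fun i => dist (X i) x ≤ r).card := by
  constructor
  · intro h
    refine (knnDist_mem hk X x).2.trans (Finset.card_le_card ?_)
    exact Finset.monotone_filter_right _ fun i _ hi => hi.trans h
  · intro h
    refine csInf_le ⟨0, fun r hr => hr.1⟩ ⟨?_, h⟩
    obtain ⟨i, hi⟩ := Finset.card_pos.1 (hk1.trans h)
    exact dist_nonneg.trans (Finset.mem_filter.1 hi).2

attribute [local irreducible] knnDist

lemma knnDist_lt_iff {k : ℕ} (hk1 : 1 ≤ k) (hk : k ≤ N) (X : Fin N → EuclideanSpace ℝ (Fin d))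
    (x : EuclideanSpace ℝ (Fin d)) (r : ℝ) :
    knnDist k X x < r ↔ k ≤ (Finset.univ.filter fun i => dist (X i) x < r).card := by
  constructor
  · intro h
    refine (knnDist_mem hk X x).2.trans (Finset.card_le_card ?_)
    exact Finset.monotone_filter_right _ fun i _ hi => lt_of_le_of_lt hi h
  · intro h
    -- The farthest of the samples strictly within `r` gives a radius smaller than `r` that captures
    -- all of them.
    obtain ⟨i, hi, hmax⟩ := Finset.exists_max_image _ (fun i => dist (X i) x)
      (Finset.card_pos.1 (hk1.trans h))
    refine lt_of_le_of_lt ?_ (Finset.mem_filter.1 hi).2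
    rw [knnDist_le_iff hk1 hk]
    refine h.trans (Finset.card_le_card fun j hj => ?_)
    simpa using hmax j hj

lemma measurable_knnDist {k : ℕ} (hk1 : 1 ≤ k) (hk : k ≤ N) :
    Measurable fun q : (Fin N → EuclideanSpace ℝ (Fin d)) × EuclideanSpace ℝ (Fin d) =>
      knnDist k q.1 q.2 := by
  refine measurable_of_Iic fun r => ?_
  have : (fun q : (Fin N → EuclideanSpace ℝ (Fin d)) × EuclideanSpace ℝ (Fin d) =>
      knnDist k q.1 q.2) ⁻¹' Iic r =
      (fun q : (Fin N → EuclideanSpace ℝ (Fin d)) × EuclideanSpace ℝ (Fin d) =>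
        ∑ i, if dist (q.1 i) q.2 ≤ r then 1 else 0) ⁻¹' Ici k := by
    ext q
    rw [mem_preimage, mem_Iic, knnDist_le_iff hk1 hk, Finset.card_filter, mem_preimage, mem_Ici]
  rw [this]
  refine Measurable.of_discrete |>.comp (g := fun n : ℕ => n) ?_ measurableSet_Ici
  refine Finset.measurable_sum _ fun i _ => Measurable.ite ?_ measurable_const measurable_const
  exact measurableSet_le (((measurable_pi_apply i).comp measurable_fst).dist measurable_snd)
    measurable_const

lemma measurable_knnDist_left {k : ℕ} (hk1 : 1 ≤ k) (hk : k ≤ N)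
    (x : EuclideanSpace ℝ (Fin d)) :
    Measurable fun X : Fin N → EuclideanSpace ℝ (Fin d) => knnDist k X x :=
  (measurable_knnDist hk1 hk).comp (measurable_id.prodMk measurable_const)

lemma card_filter_succAbove (p : Fin (N + 1) → Prop) [DecidablePred p] (i : Fin (N + 1)) :
    (Finset.univ.filter p).card =
      (if p i then 1 else 0) + (Finset.univ.filter fun j => p (i.succAbove j)).card := by
  rw [Finset.card_filter, Finset.card_filter, Fin.sum_univ_succAbove _ i]

/-- At least `k` indices `i` have the property that deleting `X i` makes `ρ` the `k`-th distance of
the remaining samples, with `X i` inside the closed ball. Each contributes `φ ρ` to the sum. -/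
lemma mul_le_sum_leaveOneOut {k : ℕ} (hk1 : 1 ≤ k) (hk : k ≤ N)
    (X : Fin (N + 1) → EuclideanSpace ℝ (Fin d)) (x : EuclideanSpace ℝ (Fin d))
    (φ : ℝ → ℝ≥0∞) :
    k * φ (knnDist (k + 1) X x) ≤
      ∑ i, if dist (X i) x ≤ knnDist k (fun j => X (i.succAbove j)) x
        then φ (knnDist k (fun j => X (i.succAbove j)) x) else 0 := by
  set ρ := knnDist (k + 1) X x with hρ
  have hle : k + 1 ≤ (Finset.univ.filter fun i => dist (X i) x ≤ ρ).card :=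
    (knnDist_le_iff (by omega) (by omega) X x ρ).1 le_rfl
  have hlt : (Finset.univ.filter fun i => dist (X i) x < ρ).card ≤ k := by
    have := (knnDist_lt_iff (k := k + 1) (by omega) (by omega) X x ρ).not.1 (lt_irrefl _)
    omega
  -- Ties at distance `ρ` are broken by choosing exactly `k` indices, including all the strictly
  -- closer ones.
  obtain ⟨T, hT1, hT2, hTk⟩ := Finset.exists_subsuperset_card_eq
    (Finset.monotone_filter_right Finset.univ
      (fun i _ (hi : dist (X i) x < ρ) => hi.le)) hlt (by omega)
  have hTρ : ∀ i ∈ T, knnDist k (fun j => X (i.succAbove j)) x = ρ := by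
    intro i hi
    have hi2 : dist (X i) x ≤ ρ := (Finset.mem_filter.1 (hT2 hi)).2
    apply le_antisymm
    · rw [knnDist_le_iff hk1 hk]
      rw [card_filter_succAbove _ i, if_pos hi2] at hle
      omega
    · rw [← not_lt, knnDist_lt_iff hk1 hk]
      by_cases hil : dist (X i) x < ρ
      · rw [card_filter_succAbove _ i, if_pos hil] at hlt
        omega
      · have h1 := card_filter_succAbove (fun j => dist (X j) x < ρ) i
        rw [if_neg hil] at h1
        have h2 : (Finset.univ.filter fun j => dist (X j) x < ρ).card < T.card := by
          refine Finset.card_lt_card (Finset.ssubset_iff_subset_ne.2 ⟨hT1, fun h => ?_⟩)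
          rw [← h] at hi
          exact hil (Finset.mem_filter.1 hi).2
        omega
  calc (k : ℝ≥0∞) * φ ρ = ∑ i ∈ T, φ ρ := by rw [Finset.sum_const, hTk, nsmul_eq_mul]
    _ ≤ ∑ i ∈ T, if dist (X i) x ≤ knnDist k (fun j => X (i.succAbove j)) x
        then φ (knnDist k (fun j => X (i.succAbove j)) x) else 0 := by
        refine Finset.sum_le_sum fun i hi => ?_
        rw [hTρ i hi, if_pos (Finset.mem_filter.1 (hT2 hi)).2]
    _ ≤ _ := Finset.sum_le_univ_sum_of_nonneg fun _ => zero_le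

/-- If `X i` is strictly closer than the `k`-th distance of the others, putting it back makes that
distance the `(k + 1)`-st, namely `ρ`. At most `k` samples are strictly closer than `ρ`. -/
lemma sum_leaveOneOut_le_mul {k : ℕ} (hk1 : 1 ≤ k) (hk : k ≤ N)
    (X : Fin (N + 1) → EuclideanSpace ℝ (Fin d)) (x : EuclideanSpace ℝ (Fin d))
    (φ : ℝ → ℝ≥0∞) :
    (∑ i, if dist (X i) x < knnDist k (fun j => X (i.succAbove j)) x
        then φ (knnDist k (fun j => X (i.succAbove j)) x) else 0) ≤
      k * φ (knnDist (k + 1) X x) := by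
  set ρ := knnDist (k + 1) X x with hρ
  have hlt : (Finset.univ.filter fun i => dist (X i) x < ρ).card ≤ k := by
    have := (knnDist_lt_iff (k := k + 1) (by omega) (by omega) X x ρ).not.1 (lt_irrefl _)
    omega
  have hle : k + 1 ≤ (Finset.univ.filter fun i => dist (X i) x ≤ ρ).card :=
    (knnDist_le_iff (by omega) (by omega) X x ρ).1 le_rfl
  have key : ∀ i, dist (X i) x < knnDist k (fun j => X (i.succAbove j)) x →
      knnDist k (fun j => X (i.succAbove j)) x = ρ := by
    intro i hi
    apply le_antisymm
    · rw [knnDist_le_iff hk1 hk]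
      have := card_filter_succAbove (fun j => dist (X j) x ≤ ρ) i
      split_ifs at this <;> omega
    · rw [hρ, knnDist_le_iff (by omega) (by omega), card_filter_succAbove _ i, if_pos hi.le,
        add_comm]
      exact Nat.add_le_add_left ((knnDist_le_iff hk1 hk _ x _).1 le_rfl) 1
  calc _ ≤ ∑ i, if dist (X i) x < ρ then φ ρ else 0 := by
        refine Finset.sum_le_sum fun i _ => ?_
        split_ifs with h1 h2 h2
        · rw [key i h1]
        · rw [key i h1] at h1; exact absurd h1 h2
        · exact zero_le
        · exact le_rfl
    _ = (Finset.univ.filter fun i => dist (X i) x < ρ).card * φ ρ := by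
        rw [← Finset.sum_filter, Finset.sum_const, nsmul_eq_mul]
    _ ≤ _ := by gcongr

lemma lintegral_pi_succAbove {E : Type*} [MeasurableSpace E] (P : Measure E)
    [IsProbabilityMeasure P] (i : Fin (N + 1)) {g : E → (Fin N → E) → ℝ≥0∞}
    (hg : Measurable (Function.uncurry g)) :
    ∫⁻ X : Fin (N + 1) → E, g (X i) (fun j => X (i.succAbove j)) ∂(Measure.pi fun _ => P) =
      ∫⁻ Y : Fin N → E, ∫⁻ y, g y Y ∂P ∂(Measure.pi fun _ => P) := by
  have h := (measurePreserving_piFinSuccAbove (fun _ : Fin (N + 1) => P) i).lintegral_comp hg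
  rw [lintegral_prod_symm _ hg.aemeasurable] at h
  exact h

/-- Exchangeability: every index contributes the same integral, in which the deleted sample is
independent of the rest. -/
lemma lintegral_sum_leaveOneOut {E : Type*} [MeasurableSpace E] (P : Measure E)
    [IsProbabilityMeasure P] {g : E → (Fin N → E) → ℝ≥0∞}
    (hg : Measurable (Function.uncurry g)) :
    ∫⁻ X : Fin (N + 1) → E, ∑ i, g (X i) (fun j => X (i.succAbove j)) ∂(Measure.pi fun _ => P) =
      (N + 1 : ℕ) * ∫⁻ Y : Fin N → E, ∫⁻ y, g y Y ∂P ∂(Measure.pi fun _ => P) := by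
  have hgi : ∀ i : Fin (N + 1), Measurable fun X : Fin (N + 1) → E =>
      g (X i) (fun j => X (i.succAbove j)) := fun i =>
    hg.comp (g := Function.uncurry g)
      (f := fun X : Fin (N + 1) → E => (X i, fun j => X (i.succAbove j)))
      ((measurable_pi_apply i).prodMk (measurable_pi_lambda _ fun j => measurable_pi_apply _))
  rw [lintegral_finsetSum _ fun i _ => hgi i,
    Finset.sum_congr rfl fun i _ => lintegral_pi_succAbove P i hg, Finset.sum_const,
    Finset.card_univ, Fintype.card_fin, nsmul_eq_mul]

lemma measurable_measure_closedBall (P : Measure (EuclideanSpace ℝ (Fin d)))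
    (x : EuclideanSpace ℝ (Fin d)) :
    Measurable fun r : ℝ => P (Metric.closedBall x r) :=
  Monotone.measurable fun _ _ h => measure_mono (Metric.closedBall_subset_closedBall h)

variable (P : Measure (EuclideanSpace ℝ (Fin d))) [IsProbabilityMeasure P]

/-- Raising both the order and the sample size by one trades a factor `P (closedBall x ρ)`. -/
theorem mul_lintegral_knnDist_succ_le {k : ℕ} (hk1 : 1 ≤ k) (hk : k ≤ N)
    (x : EuclideanSpace ℝ (Fin d)) {φ : ℝ → ℝ≥0∞} (hφ : Measurable φ) :
    k * ∫⁻ X : Fin (N + 1) → EuclideanSpace ℝ (Fin d), φ (knnDist (k + 1) X x)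
        ∂(Measure.pi fun _ => P) ≤
      (N + 1 : ℕ) * ∫⁻ X : Fin N → EuclideanSpace ℝ (Fin d),
        P (Metric.closedBall x (knnDist k X x)) * φ (knnDist k X x)
        ∂(Measure.pi fun _ => P) := by
  have hρ := measurable_knnDist_left (d := d) hk1 hk x
  have hρ' := measurable_knnDist_left (d := d) (k := k + 1) (N := N + 1) (by omega) (by omega) x
  have hg : Measurable (Function.uncurry
      fun (y : EuclideanSpace ℝ (Fin d)) (Y : Fin N → EuclideanSpace ℝ (Fin d)) =>
        if dist y x ≤ knnDist k Y x then φ (knnDist k Y x) else 0) := by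
    refine Measurable.ite ?_ (hφ.comp (hρ.comp measurable_snd)) measurable_const
    exact measurableSet_le (measurable_fst.dist measurable_const) (hρ.comp measurable_snd)
  have hφρ : Measurable fun X : Fin (N + 1) → EuclideanSpace ℝ (Fin d) =>
      φ (knnDist (k + 1) X x) := hφ.comp hρ'
  rw [← lintegral_const_mul _ hφρ]
  refine (lintegral_mono fun X => mul_le_sum_leaveOneOut hk1 hk X x φ).trans ?_
  rw [lintegral_sum_leaveOneOut P hg]
  refine le_of_eq (congrArg _ (lintegral_congr fun Y => ?_))
  have : (fun y => if dist y x ≤ knnDist k Y x then φ (knnDist k Y x) else 0) =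
      (Metric.closedBall x (knnDist k Y x)).indicator fun _ => φ (knnDist k Y x) := by
    funext y
    classical
    simp only [indicator_apply, Metric.mem_closedBall]
  rw [this, lintegral_indicator Metric.isClosed_closedBall.measurableSet,
    setLIntegral_const, mul_comm]

/-- The converse of `mul_lintegral_knnDist_succ_le`, with the open ball in place of the closed one;
the two together are an equality when spheres carry no mass. -/
theorem le_mul_lintegral_knnDist_succ {k : ℕ} (hk1 : 1 ≤ k) (hk : k ≤ N)
    (x : EuclideanSpace ℝ (Fin d)) {φ : ℝ → ℝ≥0∞} (hφ : Measurable φ) :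
    (N + 1 : ℕ) * ∫⁻ X : Fin N → EuclideanSpace ℝ (Fin d),
        P (Metric.ball x (knnDist k X x)) * φ (knnDist k X x)
        ∂(Measure.pi fun _ => P) ≤
    k * ∫⁻ X : Fin (N + 1) → EuclideanSpace ℝ (Fin d), φ (knnDist (k + 1) X x)
        ∂(Measure.pi fun _ => P) := by
  have hρ := measurable_knnDist_left (d := d) hk1 hk x
  have hρ' := measurable_knnDist_left (d := d) (k := k + 1) (N := N + 1) (by omega) (by omega) x
  have hg : Measurable (Function.uncurry
      fun (y : EuclideanSpace ℝ (Fin d)) (Y : Fin N → EuclideanSpace ℝ (Fin d)) =>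
        if dist y x < knnDist k Y x then φ (knnDist k Y x) else 0) := by
    refine Measurable.ite ?_ (hφ.comp (hρ.comp measurable_snd)) measurable_const
    exact measurableSet_lt (measurable_fst.dist measurable_const) (hρ.comp measurable_snd)
  have hφρ : Measurable fun X : Fin (N + 1) → EuclideanSpace ℝ (Fin d) =>
      φ (knnDist (k + 1) X x) := hφ.comp hρ'
  rw [← lintegral_const_mul _ hφρ]
  refine le_trans (le_of_eq ?_)
    (lintegral_mono fun X => sum_leaveOneOut_le_mul hk1 hk X x φ)
  rw [lintegral_sum_leaveOneOut P hg]
  refine congrArg _ (lintegral_congr fun Y => ?_)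
  have : (fun y => if dist y x < knnDist k Y x then φ (knnDist k Y x) else 0) =
      (Metric.ball x (knnDist k Y x)).indicator fun _ => φ (knnDist k Y x) := by
    funext y
    classical
    simp only [indicator_apply, Metric.mem_ball]
  rw [this, lintegral_indicator Metric.isOpen_ball.measurableSet,
    setLIntegral_const, mul_comm]

end OrderStatistic

/-! ### Inverse moments of the probability of the nearest-neighbour ball. -/

section Moments

variable {d N : ℕ}

attribute [local irreducible] knnDist

lemma measurable_measure_knnBall (P : Measure (EuclideanSpace ℝ (Fin d))) {k : ℕ} (hk1 : 1 ≤ k)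
    (hk : k ≤ N) (x : EuclideanSpace ℝ (Fin d)) :
    Measurable fun X : Fin N → EuclideanSpace ℝ (Fin d) =>
      P (Metric.closedBall x (knnDist k X x)) :=
  (measurable_measure_closedBall P x).comp (measurable_knnDist_left hk1 hk x)

lemma measurable_inv_measure_knnBall (P : Measure (EuclideanSpace ℝ (Fin d))) {k : ℕ}
    (hk1 : 1 ≤ k) (hk : k ≤ N) (x : EuclideanSpace ℝ (Fin d)) :
    Measurable fun X : Fin N → EuclideanSpace ℝ (Fin d) =>
      (P (Metric.closedBall x (knnDist k X x)))⁻¹ :=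
  (measurable_measure_knnBall P hk1 hk x).inv

lemma measure_ball_eq_closedBall (P : Measure (EuclideanSpace ℝ (Fin d))) (hd : 1 ≤ d) (hP : P ≪ volume)
    (x : EuclideanSpace ℝ (Fin d)) (r : ℝ) : P (Metric.ball x r) = P (Metric.closedBall x r) := by
  have : Nonempty (Fin d) := ⟨⟨0, hd⟩⟩
  refine le_antisymm (measure_mono Metric.ball_subset_closedBall) ?_
  rw [← Metric.ball_union_sphere]
  refine (measure_union_le _ _).trans ?_
  rw [hP (Measure.addHaar_sphere volume x r), add_zero]

/-- The ratio of the nominal to the actual probability of the `k`-nearest-neighbour ball. -/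
noncomputable def knnRatio (P : Measure (EuclideanSpace ℝ (Fin d))) (N k : ℕ)
    (x : EuclideanSpace ℝ (Fin d)) (X : Fin N → EuclideanSpace ℝ (Fin d)) : ℝ :=
  ((k : ℝ) - 1) / (N * (P (Metric.closedBall x (knnDist k X x))).toReal)

lemma measurable_knnRatio (P : Measure (EuclideanSpace ℝ (Fin d))) {k : ℕ} (hk1 : 1 ≤ k) (hk : k ≤ N)
    (x : EuclideanSpace ℝ (Fin d)) : Measurable (knnRatio P N k x) :=
  ((measurable_measure_knnBall P hk1 hk x).ennreal_toReal.const_mul _).const_div _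

variable (P : Measure (EuclideanSpace ℝ (Fin d))) [IsProbabilityMeasure P]

/-- The first inverse moment of the probability of the `k`-nearest-neighbour ball. -/
lemma mul_lintegral_inv_knnBall_le {k : ℕ} (hk1 : 1 ≤ k) (hk : k ≤ N)
    (x : EuclideanSpace ℝ (Fin d)) :
    k * ∫⁻ X : Fin (N + 1) → EuclideanSpace ℝ (Fin d),
      (P (Metric.closedBall x (knnDist (k + 1) X x)))⁻¹ ∂(Measure.pi fun _ => P) ≤
      (N + 1 : ℕ) := by
  refine (mul_lintegral_knnDist_succ_le P hk1 hk x
    (φ := fun r => (P (Metric.closedBall x r))⁻¹)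
    (measurable_measure_closedBall P x).inv).trans ?_
  conv_rhs => rw [← mul_one ((N + 1 : ℕ) : ℝ≥0∞)]
  gcongr
  calc _ ≤ ∫⁻ X : Fin N → EuclideanSpace ℝ (Fin d), 1 ∂(Measure.pi fun _ => P) :=
        lintegral_mono fun X => ENNReal.mul_inv_le_one _
    _ = 1 := by simp

/-- The second inverse moment of the probability of the `k`-nearest-neighbour ball. -/
lemma mul_lintegral_inv_sq_knnBall_le {k : ℕ} (hk1 : 1 ≤ k) (hk : k ≤ N)
    (x : EuclideanSpace ℝ (Fin d)) :
    k * ((k + 1 : ℕ) * ∫⁻ X : Fin (N + 2) → EuclideanSpace ℝ (Fin d),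
      (P (Metric.closedBall x (knnDist (k + 2) X x)))⁻¹ ^ 2 ∂(Measure.pi fun _ => P)) ≤
      (N + 2 : ℕ) * (N + 1 : ℕ) := by
  have h1 := mul_lintegral_knnDist_succ_le P (k := k + 1) (N := N + 1) (by omega) (by omega) x
    (φ := fun r => (P (Metric.closedBall x r))⁻¹ ^ 2)
    ((measurable_measure_closedBall P x).inv.pow_const 2)
  have h2 : ∫⁻ X : Fin (N + 1) → EuclideanSpace ℝ (Fin d),
      P (Metric.closedBall x (knnDist (k + 1) X x)) *
        (P (Metric.closedBall x (knnDist (k + 1) X x)))⁻¹ ^ 2 ∂(Measure.pi fun _ => P) ≤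
      ∫⁻ X : Fin (N + 1) → EuclideanSpace ℝ (Fin d),
        (P (Metric.closedBall x (knnDist (k + 1) X x)))⁻¹ ∂(Measure.pi fun _ => P) := by
    refine lintegral_mono fun X => ?_
    rw [pow_two, ← mul_assoc]
    exact mul_le_of_le_one_left zero_le (ENNReal.mul_inv_le_one _)
  calc _ ≤ (k : ℝ≥0∞) * ((N + 2 : ℕ) * ∫⁻ X : Fin (N + 1) → EuclideanSpace ℝ (Fin d),
        (P (Metric.closedBall x (knnDist (k + 1) X x)))⁻¹ ∂(Measure.pi fun _ => P)) := by
        refine mul_le_mul_right (h1.trans (mul_le_mul_right h2 _)) _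
    _ = (N + 2 : ℕ) * (k * ∫⁻ X : Fin (N + 1) → EuclideanSpace ℝ (Fin d),
        (P (Metric.closedBall x (knnDist (k + 1) X x)))⁻¹ ∂(Measure.pi fun _ => P)) := by ring
    _ ≤ _ := by
        gcongr
        exact mul_lintegral_inv_knnBall_le P hk1 hk x

/-- The inverse has a finite mean and `0⁻¹ = ∞`, so the probability vanishes only on a null set. -/
lemma ae_measure_knnBall_ne_zero {k : ℕ} (hk1 : 1 ≤ k) (hk : k ≤ N)
    (x : EuclideanSpace ℝ (Fin d)) :
    ∀ᵐ X : Fin (N + 1) → EuclideanSpace ℝ (Fin d) ∂(Measure.pi fun _ => P),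
      P (Metric.closedBall x (knnDist (k + 1) X x)) ≠ 0 := by
  have h := mul_lintegral_inv_knnBall_le P hk1 hk x
  have hfin : ∫⁻ X : Fin (N + 1) → EuclideanSpace ℝ (Fin d),
      (P (Metric.closedBall x (knnDist (k + 1) X x)))⁻¹ ∂(Measure.pi fun _ => P) ≠ ∞ := by
    intro h'
    rw [h', ENNReal.mul_top (by simpa using (by omega : k ≠ 0))] at h
    exact (ENNReal.natCast_lt_top (N + 1)).not_ge h
  filter_upwards [ae_lt_top
    (measurable_inv_measure_knnBall P (by omega) (by omega) x) hfin] with X hX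
  rw [ENNReal.inv_lt_top] at hX
  exact hX.ne'

/-- Here `p * p⁻¹` must equal `1` almost everywhere, so `p` must be nonzero already for order `k +
1`; this is why the order is raised to `k + 2`. -/
lemma le_mul_lintegral_inv_knnBall (hd : 1 ≤ d) (hP : P ≪ volume) {k : ℕ} (hk1 : 1 ≤ k)
    (hk : k ≤ N) (x : EuclideanSpace ℝ (Fin d)) :
    ((N + 2 : ℕ) : ℝ≥0∞) ≤ (k + 1 : ℕ) * ∫⁻ X : Fin (N + 2) → EuclideanSpace ℝ (Fin d),
      (P (Metric.closedBall x (knnDist (k + 2) X x)))⁻¹ ∂(Measure.pi fun _ => P) := by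
  refine le_trans (le_of_eq ?_) (le_mul_lintegral_knnDist_succ P (k := k + 1) (N := N + 1)
    (by omega) (by omega) x (φ := fun r => (P (Metric.closedBall x r))⁻¹)
    (measurable_measure_closedBall P x).inv)
  have h1 : ∫⁻ X : Fin (N + 1) → EuclideanSpace ℝ (Fin d),
      P (Metric.ball x (knnDist (k + 1) X x)) *
        (P (Metric.closedBall x (knnDist (k + 1) X x)))⁻¹ ∂(Measure.pi fun _ => P) = 1 := by
    calc _ = ∫⁻ X : Fin (N + 1) → EuclideanSpace ℝ (Fin d), 1 ∂(Measure.pi fun _ => P) := by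
          refine lintegral_congr_ae ?_
          filter_upwards [ae_measure_knnBall_ne_zero P hk1 hk x] with X hX
          rw [measure_ball_eq_closedBall P hd hP, ENNReal.mul_inv_cancel hX (measure_ne_top _ _)]
      _ = 1 := by simp
  rw [h1, mul_one]

lemma ofReal_knnRatio {k : ℕ} (hk1 : 1 ≤ k) (hN : 1 ≤ N) (x : EuclideanSpace ℝ (Fin d))
    (X : Fin N → EuclideanSpace ℝ (Fin d))
    (h0 : P (Metric.closedBall x (knnDist k X x)) ≠ 0) :
    ENNReal.ofReal (knnRatio P N k x X) =
      ENNReal.ofReal (((k : ℝ) - 1) / N) * (P (Metric.closedBall x (knnDist k X x)))⁻¹ := by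
  have hk1' : (1 : ℝ) ≤ k := by exact_mod_cast hk1
  have hN' : (1 : ℝ) ≤ N := by exact_mod_cast hN
  have hp : 0 < (P (Metric.closedBall x (knnDist k X x))).toReal :=
    ENNReal.toReal_pos h0 (measure_ne_top _ _)
  rw [knnRatio, ← div_div, div_eq_mul_inv (((k : ℝ) - 1) / N), ENNReal.ofReal_mul
    (div_nonneg (by linarith) (by linarith)), ENNReal.ofReal_inv_of_pos hp,
    ENNReal.ofReal_toReal (measure_ne_top _ _)]

lemma lintegral_knnRatio_le {k : ℕ} (hk2 : 2 ≤ k) (hk : k ≤ N) (x : EuclideanSpace ℝ (Fin d)) :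
    ∫⁻ X, ENNReal.ofReal (knnRatio P N k x X) ∂(Measure.pi fun _ => P) ≤ 1 := by
  obtain ⟨j, rfl⟩ : ∃ j, k = j + 1 := ⟨k - 1, by omega⟩
  obtain ⟨n, rfl⟩ : ∃ n, N = n + 1 := ⟨N - 1, by omega⟩
  have h := mul_lintegral_inv_knnBall_le P (k := j) (N := n) (by omega) (by omega) x
  rw [lintegral_congr_ae (g := fun X => ENNReal.ofReal ((((j + 1 : ℕ) : ℝ) - 1) / (n + 1 : ℕ)) *
      (P (Metric.closedBall x (knnDist (j + 1) X x)))⁻¹) ?_,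
    lintegral_const_mul _ (measurable_inv_measure_knnBall P (by omega) (by omega) x)]
  · have e : ENNReal.ofReal ((((j + 1 : ℕ) : ℝ) - 1) / (n + 1 : ℕ)) =
        ((n + 1 : ℕ) : ℝ≥0∞)⁻¹ * j := by
      rw [Nat.cast_add_one, add_sub_cancel_right, ENNReal.ofReal_div_of_pos (by positivity),
        ENNReal.ofReal_natCast, ENNReal.ofReal_natCast, ENNReal.div_eq_inv_mul]
    rw [e, mul_assoc]
    calc _ ≤ ((n + 1 : ℕ) : ℝ≥0∞)⁻¹ * (n + 1 : ℕ) := by gcongr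
      _ ≤ 1 := ENNReal.inv_mul_le_one _
  · filter_upwards [ae_measure_knnBall_ne_zero P (k := j) (N := n) (by omega) (by omega) x]
      with X hX
    exact ofReal_knnRatio P (by omega) (by omega) x X hX

lemma one_le_lintegral_knnRatio (hd : 1 ≤ d) (hP : P ≪ volume) {k : ℕ} (hk3 : 3 ≤ k)
    (hk : k ≤ N) (x : EuclideanSpace ℝ (Fin d)) :
    1 ≤ ∫⁻ X, ENNReal.ofReal (knnRatio P N k x X) ∂(Measure.pi fun _ => P) := by
  obtain ⟨j, rfl⟩ : ∃ j, k = j + 2 := ⟨k - 2, by omega⟩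
  obtain ⟨n, rfl⟩ : ∃ n, N = n + 2 := ⟨N - 2, by omega⟩
  have h := le_mul_lintegral_inv_knnBall P hd hP (k := j) (N := n) (by omega) (by omega) x
  rw [lintegral_congr_ae (g := fun X => ENNReal.ofReal ((((j + 2 : ℕ) : ℝ) - 1) / (n + 2 : ℕ)) *
      (P (Metric.closedBall x (knnDist (j + 2) X x)))⁻¹) ?_,
    lintegral_const_mul _ (measurable_inv_measure_knnBall P (by omega) (by omega) x)]
  · have e : ENNReal.ofReal ((((j + 2 : ℕ) : ℝ) - 1) / (n + 2 : ℕ)) =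
        ((n + 2 : ℕ) : ℝ≥0∞)⁻¹ * (j + 1 : ℕ) := by
      rw [show (((j + 2 : ℕ) : ℝ) - 1) = (j + 1 : ℕ) by push_cast; ring,
        ENNReal.ofReal_div_of_pos (by positivity),
        ENNReal.ofReal_natCast, ENNReal.ofReal_natCast, ENNReal.div_eq_inv_mul]
    rw [e, mul_assoc]
    calc (1 : ℝ≥0∞) = ((n + 2 : ℕ) : ℝ≥0∞)⁻¹ * (n + 2 : ℕ) :=
          (ENNReal.inv_mul_cancel (by simp) (ENNReal.natCast_ne_top _)).symm
      _ ≤ _ := by gcongr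
  · filter_upwards [ae_measure_knnBall_ne_zero P (k := j + 1) (N := n + 1) (by omega) (by omega) x]
      with X hX
    exact ofReal_knnRatio P (by omega) (by omega) x X hX

/-- The second inverse moment gives `(k - 1) / (k - 2) * ((N - 1) / N)`, and the last factor is
dropped. -/
lemma lintegral_knnRatio_sq_le {k : ℕ} (hk3 : 3 ≤ k) (hk : k ≤ N)
    (x : EuclideanSpace ℝ (Fin d)) :
    ∫⁻ X, ENNReal.ofReal (knnRatio P N k x X) ^ 2 ∂(Measure.pi fun _ => P) ≤
      ENNReal.ofReal (((k : ℝ) - 1) / (k - 2)) := by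
  obtain ⟨j, rfl⟩ : ∃ j, k = j + 2 := ⟨k - 2, by omega⟩
  obtain ⟨n, rfl⟩ : ∃ n, N = n + 2 := ⟨N - 2, by omega⟩
  have hj : (1 : ℝ) ≤ j := by exact_mod_cast (by omega : 1 ≤ j)
  have h := mul_lintegral_inv_sq_knnBall_le P (k := j) (N := n) (by omega) (by omega) x
  set I := ∫⁻ X : Fin (n + 2) → EuclideanSpace ℝ (Fin d),
      (P (Metric.closedBall x (knnDist (j + 2) X x)))⁻¹ ^ 2 ∂(Measure.pi fun _ => P) with hI
  have hI' : I ≤ ENNReal.ofReal (((n : ℝ) + 2) * (n + 1) / (j * (j + 1))) := by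
    rw [ENNReal.ofReal_div_of_pos (by positivity), ENNReal.le_div_iff_mul_le
      (Or.inl (ENNReal.ofReal_pos.2 (by positivity)).ne') (Or.inl ENNReal.ofReal_ne_top)]
    have e1 : ENNReal.ofReal ((j : ℝ) * (j + 1)) = j * (j + 1 : ℕ) := by
      rw [← Nat.cast_add_one, ← Nat.cast_mul, ENNReal.ofReal_natCast, Nat.cast_mul]
    have e2 : ENNReal.ofReal (((n : ℝ) + 2) * (n + 1)) = (n + 2 : ℕ) * (n + 1 : ℕ) := by
      rw [show ((n : ℝ) + 2) * (n + 1) = (((n + 2) * (n + 1) : ℕ) : ℝ) by push_cast; ring,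
        ENNReal.ofReal_natCast, Nat.cast_mul]
    rw [e1, e2, mul_comm, mul_assoc]
    exact h
  rw [lintegral_congr_ae (g := fun X => ENNReal.ofReal ((((j + 2 : ℕ) : ℝ) - 1) / (n + 2 : ℕ)) ^ 2 *
      (P (Metric.closedBall x (knnDist (j + 2) X x)))⁻¹ ^ 2) ?_,
    lintegral_const_mul _
      ((measurable_inv_measure_knnBall P (by omega) (by omega) x).pow_const 2)]
  · rw [← hI]
    calc _ ≤ ENNReal.ofReal ((((j + 2 : ℕ) : ℝ) - 1) / (n + 2 : ℕ)) ^ 2 *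
          ENNReal.ofReal (((n : ℝ) + 2) * (n + 1) / (j * (j + 1))) := by gcongr
      _ ≤ _ := by
        have h0 : 0 ≤ (((j + 2 : ℕ) : ℝ) - 1) / (n + 2 : ℕ) := by
          push_cast; apply div_nonneg <;> linarith [(Nat.cast_nonneg n : (0 : ℝ) ≤ n)]
        rw [← ENNReal.ofReal_pow h0, ← ENNReal.ofReal_mul (by positivity)]
        apply ENNReal.ofReal_le_ofReal
        push_cast
        rw [show (j : ℝ) + 2 - 1 = j + 1 by ring, show (j : ℝ) + 2 - 2 = j by ring]
        have e : (((j : ℝ) + 1) / (n + 2)) ^ 2 * (((n : ℝ) + 2) * (n + 1) / (j * (j + 1))) =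
            ((j : ℝ) + 1) / j * ((n + 1) / (n + 2)) := by field_simp
        rw [e]
        apply mul_le_of_le_one_right (by positivity)
        rw [div_le_one (by positivity)]; linarith
  · filter_upwards [ae_measure_knnBall_ne_zero P (k := j + 1) (N := n + 1) (by omega) (by omega) x]
      with X hX
    rw [ofReal_knnRatio P (by omega) (by omega) x X hX, mul_pow]

lemma lintegral_knnRatio_sub_one_sq_le (hd : 1 ≤ d) (hP : P ≪ volume) {k : ℕ} (hk3 : 3 ≤ k)
    (hk : k ≤ N) (x : EuclideanSpace ℝ (Fin d)) :
    ∫⁻ X, ENNReal.ofReal ((knnRatio P N k x X - 1) ^ 2) ∂(Measure.pi fun _ => P) ≤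
      ENNReal.ofReal (1 / ((k : ℝ) - 2)) := by
  have hk3' : (3 : ℝ) ≤ k := by exact_mod_cast hk3
  have hZm := measurable_knnRatio P (by omega) hk x
  have hZ0 : ∀ X, 0 ≤ knnRatio P N k x X := fun X => by
    unfold knnRatio
    exact div_nonneg (by linarith) (by positivity)
  have h1 := one_le_lintegral_knnRatio P hd hP hk3 hk x
  have h2 := lintegral_knnRatio_sq_le P hk3 hk x
  -- The expansion of the square, arranged without subtraction because the integrals are in `ℝ≥0∞`.
  have e : ∫⁻ X, ENNReal.ofReal ((knnRatio P N k x X - 1) ^ 2) ∂(Measure.pi fun _ => P) +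
      2 * ∫⁻ X, ENNReal.ofReal (knnRatio P N k x X) ∂(Measure.pi fun _ => P) =
      ∫⁻ X, ENNReal.ofReal (knnRatio P N k x X) ^ 2 ∂(Measure.pi fun _ => P) + 1 := by
    rw [← lintegral_const_mul _ hZm.ennreal_ofReal,
      ← lintegral_add_left ((hZm.sub_const 1).pow_const 2).ennreal_ofReal]
    have h1 : ∫⁻ _ : Fin N → EuclideanSpace ℝ (Fin d), (1 : ℝ≥0∞) ∂(Measure.pi fun _ => P) = 1 := by
      simp
    rw [← h1, ← lintegral_add_right _ measurable_const]
    refine lintegral_congr fun X => ?_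
    rw [← ENNReal.ofReal_pow (hZ0 X), ← ENNReal.ofReal_one,
      ← ENNReal.ofReal_add (by positivity) zero_le_one,
      show (2 : ℝ≥0∞) = ENNReal.ofReal 2 by norm_num, ← ENNReal.ofReal_mul zero_le_two,
      ← ENNReal.ofReal_add (by positivity) (mul_nonneg zero_le_two (hZ0 X))]
    congr 1; ring
  have h3 : ∫⁻ X, ENNReal.ofReal ((knnRatio P N k x X - 1) ^ 2) ∂(Measure.pi fun _ => P) + 2 ≤
      ENNReal.ofReal (1 / ((k : ℝ) - 2)) + 2 := by
    calc _ ≤ ∫⁻ X, ENNReal.ofReal ((knnRatio P N k x X - 1) ^ 2) ∂(Measure.pi fun _ => P) +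
          2 * ∫⁻ X, ENNReal.ofReal (knnRatio P N k x X) ∂(Measure.pi fun _ => P) := by
          gcongr
          calc (2 : ℝ≥0∞) = 2 * 1 := by norm_num
            _ ≤ _ := by gcongr
      _ ≤ ENNReal.ofReal (((k : ℝ) - 1) / (k - 2)) + 1 := by rw [e]; gcongr
      _ = _ := by
          have : ((k : ℝ) - 1) / (k - 2) = 1 / (k - 2) + 1 := by
            have : (k : ℝ) - 2 ≠ 0 := by linarith
            field_simp; ring
          rw [this, ENNReal.ofReal_add (div_nonneg zero_le_one (by linarith)) zero_le_one,
            ENNReal.ofReal_one, add_assoc, one_add_one_eq_two]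
  exact (ENNReal.add_le_add_iff_right (by norm_num)).1 h3

/-- The ratio of the nominal to the actual probability of the `k`-nearest-neighbour ball deviates
from `1` by order `k ^ (-1/2)` in mean. -/
theorem lintegral_abs_knnRatio_sub_one_le (hd : 1 ≤ d) (hP : P ≪ volume) {k : ℕ} (hk2 : 2 ≤ k)
    (hk : k ≤ N) (x : EuclideanSpace ℝ (Fin d)) :
    ∫⁻ X, ENNReal.ofReal |knnRatio P N k x X - 1| ∂(Measure.pi fun _ => P) ≤
      ENNReal.ofReal (3 * (k : ℝ) ^ (-(1 / 2) : ℝ)) := by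
  have hZm := measurable_knnRatio P (by omega) hk x
  have hk2' : (2 : ℝ) ≤ k := by exact_mod_cast hk2
  set s : ℝ := (k : ℝ) ^ (-(1 / 2) : ℝ) with hs
  have hs0 : 0 < s := by positivity
  have hs2 : s ^ 2 = 1 / k := by
    rw [hs, ← Real.rpow_natCast, ← Real.rpow_mul (by positivity)]
    norm_num
    rw [Real.rpow_neg_one]
  -- The second-moment bound needs `k ≥ 3`. For `k = 2` the mean alone gives `E |Z - 1| ≤ 2 ≤ 3 /
  -- √2`.
  rcases hk2.eq_or_lt with h | h
  · have hs23 : 2 ≤ 3 * s := by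
      rw [← h] at hs2
      norm_num at hs2
      nlinarith
    calc _ ≤ ∫⁻ X, (ENNReal.ofReal (knnRatio P N k x X) + 1) ∂(Measure.pi fun _ => P) := by
          refine lintegral_mono fun X => ?_
          have hZ0 : 0 ≤ knnRatio P N k x X := by
            unfold knnRatio
            exact div_nonneg (by linarith) (by positivity)
          rw [← ENNReal.ofReal_one, ← ENNReal.ofReal_add hZ0 zero_le_one]
          apply ENNReal.ofReal_le_ofReal
          rw [abs_le]; constructor <;> linarith
      _ ≤ 1 + 1 := by
          rw [lintegral_add_right _ measurable_const]
          gcongr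
          · exact lintegral_knnRatio_le P hk2 hk x
          · simp
      _ = ENNReal.ofReal 2 := by norm_num
      _ ≤ _ := ENNReal.ofReal_le_ofReal hs23
  · have hk3' : (3 : ℝ) ≤ k := by exact_mod_cast h
    have hV := lintegral_knnRatio_sub_one_sq_le P hd hP h hk x
    -- In place of Cauchy–Schwarz: `|u| ≤ s / 2 + u² / (2 s)`, with `s = k ^ (-1/2)` the expected
    -- size of the deviation.
    calc _ ≤ ∫⁻ X, (ENNReal.ofReal (s / 2) + ENNReal.ofReal (1 / (2 * s)) *
            ENNReal.ofReal ((knnRatio P N k x X - 1) ^ 2)) ∂(Measure.pi fun _ => P) := by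
          refine lintegral_mono fun X => ?_
          rw [← ENNReal.ofReal_mul (by positivity), ← ENNReal.ofReal_add (by positivity)
            (by positivity)]
          apply ENNReal.ofReal_le_ofReal
          have e : s / 2 + 1 / (2 * s) * (knnRatio P N k x X - 1) ^ 2 -
              |knnRatio P N k x X - 1| = (s - |knnRatio P N k x X - 1|) ^ 2 / (2 * s) := by
            rw [sub_sq s, sq_abs]; field_simp; ring
          have : 0 ≤ (s - |knnRatio P N k x X - 1|) ^ 2 / (2 * s) := by positivity
          linarith
      _ = ENNReal.ofReal (s / 2) + ENNReal.ofReal (1 / (2 * s)) *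
            ∫⁻ X, ENNReal.ofReal ((knnRatio P N k x X - 1) ^ 2) ∂(Measure.pi fun _ => P) := by
          rw [lintegral_add_left measurable_const,
            lintegral_const_mul _ ((hZm.sub_const 1).pow_const 2).ennreal_ofReal]
          simp
      _ ≤ ENNReal.ofReal (s / 2) + ENNReal.ofReal (1 / (2 * s)) *
            ENNReal.ofReal (1 / ((k : ℝ) - 2)) := by gcongr
      _ ≤ _ := by
          rw [← ENNReal.ofReal_mul (by positivity), ← ENNReal.ofReal_add (by positivity)
            (mul_nonneg (by positivity) (div_nonneg zero_le_one (by linarith)))]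
          apply ENNReal.ofReal_le_ofReal
          have h3 : 1 / ((k : ℝ) - 2) ≤ 3 * s ^ 2 := by
            rw [hs2, div_le_iff₀ (by linarith)]
            rw [mul_one_div, div_mul_eq_mul_div, le_div_iff₀ (by linarith)]
            linarith
          calc s / 2 + 1 / (2 * s) * (1 / ((k : ℝ) - 2)) ≤ s / 2 + 1 / (2 * s) * (3 * s ^ 2) := by
                gcongr
            _ = 2 * s := by field_simp; ring
            _ ≤ 3 * s := by linarith

end Moments

/-! ### Bias, pointwise error and integrated risk of the estimator. -/

section UpperBound

variable {d : ℕ} {m M L : ℝ} {CS : ℝ≥0} {S : Set (EuclideanSpace ℝ (Fin d))}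
  {f : EuclideanSpace ℝ (Fin d) → ℝ}

/-- The law with density `f`. -/
noncomputable def densityLaw (f : EuclideanSpace ℝ (Fin d) → ℝ) :
    Measure (EuclideanSpace ℝ (Fin d)) :=
  volume.withDensity fun x => ENNReal.ofReal (f x)

namespace IsBoundedSupportDensity

lemma isProbabilityMeasure (hf : IsBoundedSupportDensity d m M L CS S f) :
    IsProbabilityMeasure (densityLaw f) :=
  ⟨by rw [densityLaw, withDensity_apply _ MeasurableSet.univ, setLIntegral_univ,
    hf.lintegral_eq_one]⟩

lemma measurableSet (hf : IsBoundedSupportDensity d m M L CS S f) (hm : 0 < m) :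
    MeasurableSet S := by
  have : S = f ⁻¹' Ioi 0 := by
    ext x
    refine ⟨fun hx => hm.trans_le (hf.lower_bound x hx), fun hx => ?_⟩
    by_contra h
    exact lt_irrefl (0 : ℝ) ((hf.eq_zero_of_notMem x h) ▸ hx)
  rw [this]
  exact hf.measurable measurableSet_Ioi

lemma nonneg (hf : IsBoundedSupportDensity d m M L CS S f) (hm : 0 < m)
    (x : EuclideanSpace ℝ (Fin d)) : 0 ≤ f x := by
  by_cases hx : x ∈ S
  · exact hm.le.trans (hf.lower_bound x hx)
  · exact (hf.eq_zero_of_notMem x hx).ge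

lemma bound_pos (hf : IsBoundedSupportDensity d m M L CS S f) (hm : 0 < m) : 0 < M := by
  rcases S.eq_empty_or_nonempty with rfl | ⟨x, hx⟩
  · have h := hf.lintegral_eq_one
    simp [hf.eq_zero_of_notMem] at h
  · exact hm.trans_le ((hf.lower_bound x hx).trans (hf.upper_bound x hx))

lemma le_bound (hf : IsBoundedSupportDensity d m M L CS S f) (hm : 0 < m)
    (x : EuclideanSpace ℝ (Fin d)) : f x ≤ M := by
  by_cases hx : x ∈ S
  · exact hf.upper_bound x hx
  · exact (hf.eq_zero_of_notMem x hx).trans_le (hf.bound_pos hm).le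

lemma law_le (c : ℝ) {A : Set (EuclideanSpace ℝ (Fin d))} (hA : MeasurableSet A)
    (h : ∀ x ∈ A, f x ≤ c) : densityLaw f A ≤ ENNReal.ofReal c * volume A := by
  rw [densityLaw, withDensity_apply _ hA, ← setLIntegral_const]
  exact setLIntegral_mono measurable_const fun x hx => ENNReal.ofReal_le_ofReal (h x hx)

lemma le_law (hf : IsBoundedSupportDensity d m M L CS S f) (hm : 0 < m) (c : ℝ)
    {A : Set (EuclideanSpace ℝ (Fin d))} (hA : MeasurableSet A)
    (h : ∀ x ∈ A ∩ S, c ≤ f x) : ENNReal.ofReal c * volume (A ∩ S) ≤ densityLaw f A := by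
  have hS := hf.measurableSet hm
  refine le_trans ?_ (measure_mono (inter_subset_left (s := A) (t := S)))
  rw [densityLaw, withDensity_apply _ (hA.inter hS), ← setLIntegral_const]
  exact setLIntegral_mono hf.measurable.ennreal_ofReal
    fun x hx => ENNReal.ofReal_le_ofReal (h x hx)

lemma volume_le (hf : IsBoundedSupportDensity d m M L CS S f) (hm : 0 < m) :
    volume S ≤ ENNReal.ofReal (1 / m) := by
  have := hf.isProbabilityMeasure
  have h := hf.le_law hm m MeasurableSet.univ fun x hx => hf.lower_bound x hx.2
  rw [univ_inter, measure_univ] at h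
  rw [ENNReal.ofReal_div_of_pos hm, ENNReal.ofReal_one, ENNReal.le_div_iff_mul_le
    (Or.inl (ENNReal.ofReal_pos.2 hm).ne') (Or.inl ENNReal.ofReal_ne_top), mul_comm]
  exact h

/-- The mean of the density over a ball is close to the density at the centre, up to the part of
the ball outside the support. -/
lemma abs_law_sub_le (hf : IsBoundedSupportDensity d m M L CS S f) (hm : 0 < m)
    {x : EuclideanSpace ℝ (Fin d)} (hx : x ∈ S) {ρ : ℝ} (hρ : 0 ≤ ρ) :
    |(densityLaw f (Metric.closedBall x ρ)).toReal -
        f x * (volume (Metric.closedBall x ρ)).toReal| ≤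
      |L| * ρ * (volume (Metric.closedBall x ρ)).toReal +
        M * (volume (Metric.closedBall x ρ \ S)).toReal := by
  have := hf.isProbabilityMeasure
  have hS := hf.measurableSet hm
  have hBm : MeasurableSet (Metric.closedBall x ρ) := Metric.isClosed_closedBall.measurableSet
  have hBfin : volume (Metric.closedBall x ρ) ≠ ∞ := measure_closedBall_lt_top.ne
  have hlip : ∀ y ∈ Metric.closedBall x ρ ∩ S, |f y - f x| ≤ |L| * ρ := fun y hy =>
    (hf.lipschitz y hy.2 x hx).trans (by
      rw [← dist_eq_norm]
      exact mul_le_mul (le_abs_self L) hy.1 dist_nonneg (abs_nonneg L))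
  have hfx := hf.nonneg hm x
  have hfM := hf.le_bound hm x
  have hM := hf.bound_pos hm
  have hLρ : 0 ≤ |L| * ρ := by positivity
  -- Off `S` the density is zero, so the upper estimate holds on the whole ball; only the lower
  -- estimate loses the part outside `S`.
  have hup : (densityLaw f (Metric.closedBall x ρ)).toReal ≤
      (f x + |L| * ρ) * (volume (Metric.closedBall x ρ)).toReal := by
    have h := law_le (f := f) (f x + |L| * ρ) hBm fun y hy => by
      by_cases hyS : y ∈ S
      · linarith [(abs_le.1 (hlip y ⟨hy, hyS⟩)).2]
      · rw [hf.eq_zero_of_notMem y hyS]; positivity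
    have := ENNReal.toReal_mono (ENNReal.mul_ne_top ENNReal.ofReal_ne_top hBfin) h
    rwa [ENNReal.toReal_mul, ENNReal.toReal_ofReal (by positivity)] at this
  have hsplit : (volume (Metric.closedBall x ρ)).toReal =
      (volume (Metric.closedBall x ρ ∩ S)).toReal +
        (volume (Metric.closedBall x ρ \ S)).toReal := by
    rw [← ENNReal.toReal_add (measure_ne_top_of_subset inter_subset_left hBfin)
      (measure_ne_top_of_subset sdiff_subset hBfin), measure_inter_add_sdiff _ hS]
  have hlow : (f x - |L| * ρ) * (volume (Metric.closedBall x ρ ∩ S)).toReal ≤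
      (densityLaw f (Metric.closedBall x ρ)).toReal := by
    rcases le_total (f x - |L| * ρ) 0 with h0 | h0
    · exact (mul_nonpos_of_nonpos_of_nonneg h0 ENNReal.toReal_nonneg).trans
        ENNReal.toReal_nonneg
    · have h := hf.le_law hm (f x - |L| * ρ) hBm fun y hy => by
        linarith [(abs_le.1 (hlip y hy)).1]
      have := ENNReal.toReal_mono (measure_ne_top _ _) h
      rwa [ENNReal.toReal_mul, ENNReal.toReal_ofReal h0] at this
  have h1 : 0 ≤ (volume (Metric.closedBall x ρ ∩ S)).toReal := ENNReal.toReal_nonneg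
  have h2 : 0 ≤ (volume (Metric.closedBall x ρ \ S)).toReal := ENNReal.toReal_nonneg
  rw [hsplit] at hup ⊢
  rw [abs_le]
  constructor <;> nlinarith [mul_nonneg hM.le h2, mul_nonneg hLρ h2, mul_le_mul_of_nonneg_right hfM h2]

end IsBoundedSupportDensity

attribute [local irreducible] knnDist

lemma measurable_knnEstimator {N k : ℕ} (hk1 : 1 ≤ k) (hk : k ≤ N) :
    Measurable fun q : (Fin N → EuclideanSpace ℝ (Fin d)) × EuclideanSpace ℝ (Fin d) =>
      knnEstimator N k q.1 q.2 := by
  have : (fun q : (Fin N → EuclideanSpace ℝ (Fin d)) × EuclideanSpace ℝ (Fin d) =>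
      knnEstimator N k q.1 q.2) = fun q =>
      ((k : ℝ) - 1) / (N * (unitBallVolume d * knnDist k q.1 q.2 ^ d)) := by
    funext q
    rw [knnEstimator, volume_closedBall_eq _ (knnDist_nonneg _ _), ENNReal.toReal_ofReal]
    exact mul_nonneg (unitBallVolume_pos d).le (pow_nonneg (knnDist_nonneg _ _) _)
  rw [this]
  exact (((measurable_knnDist hk1 hk).pow_const d).const_mul _ |>.const_mul _).const_div _

/-- Splitting of the error of `Z * (p / V)` as an estimate of `y` into a stochastic part, governed
by `|Z - 1|`, and the bias. The bias is small when the radius is small, and otherwise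
`Z` is far from `1` or much of the reference ball, of volume `Vr`, lies outside the support. -/
lemma abs_estimate_sub_le {Z p V y ρ r δρ δr Vr L M : ℝ} (hp : 0 < p) (hV : 0 < V)
    (hVr : 0 < Vr) (hL : 0 ≤ L) (hM : 0 < M) (hpV : p ≤ M * V) (hy0 : 0 ≤ y)
    (hyM : y ≤ M) (hδr : 0 ≤ δr) (hr : 0 ≤ r)
    (hbias : |p - y * V| ≤ L * ρ * V + M * δρ)
    (hsmall : ρ ≤ r → δρ ≤ δr) (hlarge : r < ρ → δr ≤ Vr / 2 → Z ≤ 1 / 2) :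
    |Z * p / V - y| ≤
      3 * M * |Z - 1| + L * r + M ^ 2 * δr / p + 2 * M * δr / Vr := by
  have hA0 : 0 ≤ p / V := by positivity
  have hAM : p / V ≤ M := by rwa [div_le_iff₀ hV]
  have hb0 := abs_nonneg (Z - 1)
  have hsto : |Z * p / V - p / V| ≤ M * |Z - 1| := by
    rw [show Z * p / V - p / V = p / V * (Z - 1) by ring, abs_mul, abs_of_nonneg hA0]
    gcongr
  have htri : |Z * p / V - y| ≤ |Z * p / V - p / V| + |p / V - y| := abs_sub_le _ _ _
  have t1 : 0 ≤ L * r := by positivity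
  have t2 : 0 ≤ M ^ 2 * δr / p := by positivity
  have t3 : 0 ≤ 2 * M * δr / Vr := by positivity
  have t4 : 0 ≤ M * |Z - 1| := by positivity
  rcases le_or_gt ρ r with h | h
  · have e : |p / V - y| = |p - y * V| / V := by
      rw [show p / V - y = (p - y * V) / V by field_simp, abs_div, abs_of_pos hV]
    have h1 : |p / V - y| ≤ L * ρ + M * (δρ / V) := by
      rw [e, div_le_iff₀ hV]
      refine hbias.trans (le_of_eq ?_)
      field_simp
    -- `V ≥ p / M` replaces `1 / V` by `1 / p`, which is a multiple of `Z` and so has a controlled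
    -- mean.
    have h2 : δρ / V ≤ M * δr / p := by
      have : δρ / V ≤ δr / V := by gcongr; exact hsmall h
      refine this.trans ?_
      rw [div_le_div_iff₀ hV hp]
      nlinarith
    have h3 : M * (δρ / V) ≤ M ^ 2 * δr / p := by
      calc M * (δρ / V) ≤ M * (M * δr / p) := by gcongr
        _ = _ := by ring
    have h4 : L * ρ ≤ L * r := by gcongr
    linarith
  · have h1 : |p / V - y| ≤ M := by rw [abs_le]; constructor <;> linarith
    -- For a large radius the bias is bounded only by `M`. This is at most `2 M |Z - 1|` in the
    -- first case, giving the total coefficient `3 M`, and at most `2 M δr / Vr` in the second.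
    rcases le_or_gt δr (Vr / 2) with h' | h'
    · have hZ2 := hlarge h h'
      have : 1 / 2 ≤ |Z - 1| := by rw [abs_sub_comm]; exact le_trans (by linarith) (le_abs_self _)
      nlinarith
    · have : M ≤ 2 * M * δr / Vr := by rw [le_div_iff₀ hVr]; nlinarith
      linarith

/-- The mean error of the nearest-neighbour estimator at a point of the support. -/
lemma lintegral_knnEstimator_sub_le (hd : 1 ≤ d) (hf : IsBoundedSupportDensity d m M L CS S f)
    (hm : 0 < m) {N k : ℕ} (hk2 : 2 ≤ k) (hk : k ≤ N) {x : EuclideanSpace ℝ (Fin d)}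
    (hx : x ∈ S) {r : ℝ} (hr : 0 < r)
    (hrk : unitBallVolume d * r ^ d = 4 * k / (m * N)) :
    ∫⁻ X : Fin N → EuclideanSpace ℝ (Fin d), ‖knnEstimator N k X x - f x‖ₑ
        ∂(Measure.pi fun _ => densityLaw f) ≤
      ENNReal.ofReal (9 * M * (k : ℝ) ^ (-(1 / 2) : ℝ) + |L| * r) +
        ENNReal.ofReal (M ^ 2 * (N / (k - 1)) + 2 * M / (unitBallVolume d * r ^ d)) *
          volume (Metric.closedBall x r \ S) := by
  have := hf.isProbabilityMeasure
  have hM := hf.bound_pos hm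
  have hS := hf.measurableSet hm
  have hk2' : (2 : ℝ) ≤ k := by exact_mod_cast hk2
  have hN2 : (2 : ℝ) ≤ N := by exact_mod_cast hk2.trans hk
  have hκ := unitBallVolume_pos d
  have hac : densityLaw f ≪ volume := withDensity_absolutelyContinuous _ _
  set Vr := unitBallVolume d * r ^ d with hVrdef
  have hVr : 0 < Vr := by positivity
  have hδfin : volume (Metric.closedBall x r \ S) ≠ ∞ :=
    measure_ne_top_of_subset sdiff_subset measure_closedBall_lt_top.ne
  set δr := (volume (Metric.closedBall x r \ S)).toReal with hδrdef
  have hδr : 0 ≤ δr := ENNReal.toReal_nonneg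
  have hVol : ∀ ρ, 0 ≤ ρ → (volume (Metric.closedBall x ρ)).toReal = unitBallVolume d * ρ ^ d := by
    intro ρ hρ
    rw [volume_closedBall_eq _ hρ, ENNReal.toReal_ofReal (by positivity)]
  have hZm := measurable_knnRatio (densityLaw f) (by omega) hk x
  have hae : ∀ᵐ X : Fin N → EuclideanSpace ℝ (Fin d) ∂(Measure.pi fun _ => densityLaw f),
      densityLaw f (Metric.closedBall x (knnDist k X x)) ≠ 0 := by
    obtain ⟨j, rfl⟩ : ∃ j, k = j + 1 := ⟨k - 1, by omega⟩
    obtain ⟨n, rfl⟩ : ∃ n, N = n + 1 := ⟨N - 1, by omega⟩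
    exact ae_measure_knnBall_ne_zero (densityLaw f) (by omega) (by omega) x
  have hpt : ∀ᵐ X : Fin N → EuclideanSpace ℝ (Fin d) ∂(Measure.pi fun _ => densityLaw f),
      ‖knnEstimator N k X x - f x‖ₑ ≤
        ENNReal.ofReal (3 * M) * ENNReal.ofReal |knnRatio (densityLaw f) N k x X - 1| +
        ENNReal.ofReal (|L| * r + 2 * M * δr / Vr) +
        ENNReal.ofReal (M ^ 2 * δr * (N / (k - 1))) *
          ENNReal.ofReal (knnRatio (densityLaw f) N k x X) := by
    filter_upwards [hae] with X hX
    set ρ := knnDist k X x with hρdef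
    have hρ0 : 0 ≤ ρ := knnDist_nonneg X x
    set p := (densityLaw f (Metric.closedBall x ρ)).toReal with hpdef
    set V := (volume (Metric.closedBall x ρ)).toReal with hVdef
    set Z := knnRatio (densityLaw f) N k x X with hZdef
    have hp : 0 < p := ENNReal.toReal_pos hX (measure_ne_top _ _)
    have hZp : Z = (k - 1) / (N * p) := rfl
    have hZ0 : 0 ≤ Z := by rw [hZp]; exact div_nonneg (by linarith) (by positivity)
    have hpV : p ≤ M * V := by
      have h := IsBoundedSupportDensity.law_le (f := f) M
        (Metric.isClosed_closedBall (x := x) (ε := ρ)).measurableSet fun y _ => hf.le_bound hm y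
      have := ENNReal.toReal_mono (ENNReal.mul_ne_top ENNReal.ofReal_ne_top
        measure_closedBall_lt_top.ne) h
      rwa [ENNReal.toReal_mul, ENNReal.toReal_ofReal hM.le] at this
    have hV : 0 < V := by
      by_contra h
      have : M * V ≤ 0 := mul_nonpos_of_nonneg_of_nonpos hM.le (not_lt.1 h)
      linarith
    have hest : knnEstimator N k X x = Z * p / V := by
      rw [hZp, knnEstimator, ← hρdef, ← hVdef]
      field_simp
    have hbound := abs_estimate_sub_le (Z := Z) (p := p) (V := V) (y := f x) (ρ := ρ) (r := r)
      (δρ := (volume (Metric.closedBall x ρ \ S)).toReal) (δr := δr) (Vr := Vr) (L := |L|)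
      (M := M) hp hV hVr (abs_nonneg L) hM hpV (hf.nonneg hm x) (hf.le_bound hm x) hδr hr.le
      (hf.abs_law_sub_le hm hx hρ0)
      (fun h => ENNReal.toReal_mono hδfin
        (measure_mono (sdiff_subset_sdiff_left (Metric.closedBall_subset_closedBall h))))
      (fun h hδ => by
        have h1 : m * (Vr - δr) ≤ p := by
          have h := (hf.le_law hm m (Metric.isClosed_closedBall (x := x) (ε := r)).measurableSet
            fun y hy => hf.lower_bound y hy.2).trans
              (measure_mono (Metric.closedBall_subset_closedBall h.le))
          have := ENNReal.toReal_mono (measure_ne_top _ _) h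
          rw [ENNReal.toReal_mul, ENNReal.toReal_ofReal hm.le] at this
          have hsplit : Vr = (volume (Metric.closedBall x r ∩ S)).toReal + δr := by
            rw [hVrdef, ← hVol r hr.le, hδrdef, ← ENNReal.toReal_add
              (measure_ne_top_of_subset inter_subset_left measure_closedBall_lt_top.ne) hδfin,
              measure_inter_add_sdiff _ hS]
          rw [hsplit, add_sub_cancel_right]
          exact this
        -- The factor `4` in the choice of `r` yields `p ≥ 2 k / N`, even with half of the ball
        -- lost, and hence `Z ≤ 1 / 2`.
        have h2 : 2 * k / N ≤ p := by
          calc 2 * (k : ℝ) / N = m * (Vr / 2) := by rw [hrk]; field_simp; ring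
            _ ≤ m * (Vr - δr) := by gcongr; linarith
            _ ≤ p := h1
        rw [hZp, div_le_iff₀ (by positivity)]
        rw [div_le_iff₀ (by linarith)] at h2
        linarith)
    rw [← hest] at hbound
    rw [← ofReal_norm, Real.norm_eq_abs, ← ENNReal.ofReal_mul (by positivity),
      ← ENNReal.ofReal_mul (mul_nonneg (by positivity)
        (div_nonneg (by linarith) (by linarith))),
      ← ENNReal.ofReal_add (by positivity) (by positivity),
      ← ENNReal.ofReal_add (by positivity) (mul_nonneg (mul_nonneg (by positivity)
        (div_nonneg (by linarith) (by linarith))) hZ0)]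
    apply ENNReal.ofReal_le_ofReal
    refine hbound.trans (le_of_eq ?_)
    -- Since `δr` does not depend on the samples, this term integrates through `E Z ≤ 1`.
    have : M ^ 2 * δr / p = M ^ 2 * δr * (N / (k - 1)) * Z := by
      have : (k : ℝ) - 1 ≠ 0 := by linarith
      rw [hZp]; field_simp
    rw [this]; ring
  refine (lintegral_mono_ae hpt).trans ?_
  rw [lintegral_add_left (by fun_prop), lintegral_add_left (by fun_prop),
    lintegral_const_mul _ (by fun_prop), lintegral_const_mul _ (by fun_prop), lintegral_const,
    measure_univ, mul_one]
  have hZ1 := lintegral_abs_knnRatio_sub_one_le (densityLaw f) hd hac hk2 hk x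
  have hZ2 := lintegral_knnRatio_le (densityLaw f) hk2 hk x
  have hs : 0 ≤ (k : ℝ) ^ (-(1 / 2) : ℝ) := by positivity
  have hNk : 0 ≤ (N : ℝ) / (k - 1) := div_nonneg (by linarith) (by linarith)
  calc _ ≤ ENNReal.ofReal (3 * M) * ENNReal.ofReal (3 * (k : ℝ) ^ (-(1 / 2) : ℝ)) +
        ENNReal.ofReal (|L| * r + 2 * M * δr / Vr) +
        ENNReal.ofReal (M ^ 2 * δr * (N / (k - 1))) * 1 := by gcongr
    _ = _ := by
        rw [mul_one, ← ENNReal.ofReal_toReal hδfin, ← hδrdef, ← ENNReal.ofReal_mul (by positivity),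
          ← ENNReal.ofReal_mul (by positivity), ← ENNReal.ofReal_add (by positivity)
          (by positivity), ← ENNReal.ofReal_add (by positivity) (by positivity),
          ← ENNReal.ofReal_add (by positivity) (by positivity)]
        congr 1
        ring

/-- The risk bound of the nearest-neighbour estimator. -/
theorem exists_l1Risk_knnEstimator_le (hd : 1 ≤ d) (m M L : ℝ) (CS : ℝ≥0) (hm : 0 < m) :
    ∃ C : ℝ, 0 < C ∧
      ∀ (S : Set (EuclideanSpace ℝ (Fin d))) (f : EuclideanSpace ℝ (Fin d) → ℝ),
        IsBoundedSupportDensity d m M L CS S f →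
        ∀ N k : ℕ, 2 ≤ k → k ≤ N →
          l1Risk N S f (knnEstimator N k) ≤
            ENNReal.ofReal
              (C * (((k : ℝ) / N) ^ (1 / (d : ℝ)) + (k : ℝ) ^ (-(1 / 2) : ℝ))) := by
  have hκ := unitBallVolume_pos d
  have hsc := sweepConst_pos d
  have hd' : (1 : ℝ) ≤ d := by exact_mod_cast hd
  set c := (4 / (m * unitBallVolume d)) ^ (1 / (d : ℝ)) with hc
  have hc0 : 0 < c := by positivity
  -- `M` and `L` enter by absolute value because their signs are unknown before a density is given;
  -- the `+ 1` makes the constant positive.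
  refine ⟨9 * |M| / m + |L| * c / m + (8 * M ^ 2 / m + 2 * |M|) * (sweepConst d * CS * c) + 1,
    by positivity, ?_⟩
  intro S f hf N k hk2 hk
  have hM := hf.bound_pos hm
  have hS := hf.measurableSet hm
  have := hf.isProbabilityMeasure
  have hk2' : (2 : ℝ) ≤ k := by exact_mod_cast hk2
  have hN2 : (2 : ℝ) ≤ N := by exact_mod_cast hk2.trans hk
  set t := ((k : ℝ) / N) ^ (1 / (d : ℝ)) with ht
  set s := (k : ℝ) ^ (-(1 / 2) : ℝ) with hs
  have ht0 : 0 < t := by positivity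
  have hs0 : 0 < s := by positivity
  have hNk : 0 ≤ (N : ℝ) / (k - 1) := div_nonneg (by linarith) (by linarith)
  have hpow : ∀ y : ℝ, 0 ≤ y → (y ^ (1 / (d : ℝ))) ^ d = y := fun y hy => by
    rw [one_div, Real.rpow_inv_natCast_pow hy (by omega)]
  set r := c * t with hr
  have hr0 : 0 < r := by positivity
  have hrk : unitBallVolume d * r ^ d = 4 * k / (m * N) := by
    rw [hr, mul_pow, hc, ht, hpow _ (by positivity), hpow _ (by positivity)]
    field_simp
  have hmeas : Measurable fun q : (Fin N → EuclideanSpace ℝ (Fin d)) × EuclideanSpace ℝ (Fin d) =>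
      ‖knnEstimator N k q.1 q.2 - f q.2‖ₑ :=
    ((measurable_knnEstimator (by omega) hk).sub (hf.measurable.comp measurable_snd)).enorm
  calc l1Risk N S f (knnEstimator N k)
      = ∫⁻ x in S, ∫⁻ X : Fin N → EuclideanSpace ℝ (Fin d), ‖knnEstimator N k X x - f x‖ₑ
        ∂(Measure.pi fun _ => densityLaw f) := by
        unfold l1Risk
        exact lintegral_lintegral_swap (μ := Measure.pi fun _ : Fin N => densityLaw f)
          (ν := volume.restrict S) hmeas.aemeasurable
    _ ≤ ∫⁻ x in S, (ENNReal.ofReal (9 * M * s + |L| * r) +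
        ENNReal.ofReal (M ^ 2 * (N / (k - 1)) + 2 * M / (unitBallVolume d * r ^ d)) *
          volume (Metric.closedBall x r \ S)) :=
        setLIntegral_mono' hS fun x hx => lintegral_knnEstimator_sub_le hd hf hm hk2 hk hx hr0 hrk
    _ = ENNReal.ofReal (9 * M * s + |L| * r) * volume S +
        ENNReal.ofReal (M ^ 2 * (N / (k - 1)) + 2 * M / (unitBallVolume d * r ^ d)) *
          ∫⁻ x in S, volume (Metric.closedBall x r \ S) := by
        rw [lintegral_add_left measurable_const, setLIntegral_const, lintegral_const_mul'
          _ _ ENNReal.ofReal_ne_top]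
    _ ≤ ENNReal.ofReal (9 * M * s + |L| * r) * ENNReal.ofReal (1 / m) +
        ENNReal.ofReal (M ^ 2 * (N / (k - 1)) + 2 * M / (unitBallVolume d * r ^ d)) *
          ENNReal.ofReal (unitBallVolume d * r ^ d * (sweepConst d * CS * r)) := by
        gcongr
        · exact hf.volume_le hm
        · exact lintegral_volume_closedBall_diff_le hd hS hf.surface_area hr0.le
    _ ≤ _ := by
        rw [← ENNReal.ofReal_mul (by positivity), ← ENNReal.ofReal_mul (by positivity),
          ← ENNReal.ofReal_add (by positivity) (by positivity)]
        apply ENNReal.ofReal_le_ofReal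
        rw [abs_of_pos hM]
        have h1 : (M ^ 2 * (N / (k - 1)) + 2 * M / (unitBallVolume d * r ^ d)) *
            (unitBallVolume d * r ^ d * (sweepConst d * CS * r)) =
            (M ^ 2 * (N / (k - 1) * (unitBallVolume d * r ^ d)) + 2 * M) *
              (sweepConst d * CS * r) := by field_simp
        -- Substituting the value of `r` leaves `4 k / ((k - 1) m)`, and `k ≤ 2 (k - 1)`.
        have h2 : N / (k - 1) * (unitBallVolume d * r ^ d) ≤ 8 / m := by
          have : 0 < (k : ℝ) - 1 := by linarith
          rw [hrk, show (N : ℝ) / (k - 1) * (4 * k / (m * N)) = 4 * k / ((k - 1) * m) by field_simp,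
            div_le_div_iff₀ (by positivity) hm]
          nlinarith
        rw [h1]
        calc _ ≤ (9 * M * s + |L| * r) * (1 / m) +
              (M ^ 2 * (8 / m) + 2 * M) * (sweepConst d * CS * r) := by gcongr
          _ = (9 * M / m) * s + (|L| * c / m +
              (8 * M ^ 2 / m + 2 * M) * (sweepConst d * CS * c)) * t := by rw [hr]; ring
          _ ≤ _ := by
            have a1 : 0 ≤ 9 * M / m := by positivity
            have a2 : 0 ≤ |L| * c / m +
              (8 * M ^ 2 / m + 2 * M) * (sweepConst d * CS * c) := by positivity
            nlinarith [mul_nonneg a1 ht0.le, mul_nonneg a2 hs0.le]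

end UpperBound

/-! ### Product densities, affinity and two-point testing. -/

section Product

variable {E : Type*} [MeasurableSpace E]

lemma lintegral_pi_prod (μ : Measure E) [SigmaFinite μ] :
    ∀ {N : ℕ} (g : Fin N → E → ℝ≥0∞), (∀ i, Measurable (g i)) →
      ∫⁻ X : Fin N → E, ∏ i, g i (X i) ∂(Measure.pi fun _ => μ) = ∏ i, ∫⁻ y, g i y ∂μ
  | 0, g, _ => by simp
  | N + 1, g, hg => by
    have ih := lintegral_pi_prod μ (fun i : Fin N => g i.succ) fun i => hg _
    have hprod : Measurable fun Y : Fin N → E => ∏ i, g i.succ (Y i) :=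
      Finset.measurable_prod _ fun i _ => (hg _).comp (measurable_pi_apply i)
    have hG : Measurable fun q : E × (Fin N → E) => g 0 q.1 * ∏ i, g i.succ (q.2 i) :=
      ((hg 0).comp measurable_fst).mul (hprod.comp measurable_snd)
    have h := (measurePreserving_piFinSuccAbove (fun _ : Fin (N + 1) => μ) 0).lintegral_comp hG
    rw [lintegral_prod_mul (hg 0).aemeasurable hprod.aemeasurable, ih] at h
    rw [Fin.prod_univ_succ, ← h]
    refine lintegral_congr fun X => ?_
    rw [Fin.prod_univ_succ]
    rfl

lemma pi_withDensity (μ : Measure E) [SigmaFinite μ] {g : E → ℝ≥0∞} (hg : Measurable g)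
    [SigmaFinite (μ.withDensity g)] (N : ℕ) :
    (Measure.pi fun _ : Fin N => μ.withDensity g) =
      (Measure.pi fun _ : Fin N => μ).withDensity fun X => ∏ i, g (X i) := by
  refine (Measure.pi_eq fun s hs => ?_)
  rw [withDensity_apply _ (MeasurableSet.univ_pi hs), ← lintegral_indicator
    (MeasurableSet.univ_pi hs)]
  have : (univ.pi s).indicator (fun X : Fin N → E => ∏ i, g (X i)) =
      fun X => ∏ i, (s i).indicator g (X i) := by
    funext X
    by_cases hX : X ∈ univ.pi s
    · rw [indicator_of_mem hX]
      exact Finset.prod_congr rfl fun i _ => (indicator_of_mem (hX i (mem_univ i)) g).symm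
    · rw [indicator_of_notMem hX]
      obtain ⟨i, hi⟩ : ∃ i, X i ∉ s i := by simpa [mem_univ_pi] using hX
      exact (Finset.prod_eq_zero (Finset.mem_univ i) (indicator_of_notMem hi g)).symm
  rw [this, lintegral_pi_prod μ _ fun i => hg.indicator (hs i)]
  refine Finset.prod_congr rfl fun i _ => ?_
  rw [lintegral_indicator (hs i), withDensity_apply _ (hs i)]

/-- With `a` the smaller number, `a * b ≤ (2 a + b / 8)²` by the arithmetic-geometric inequality.
Being linear in the minimum, the bound integrates directly, and the second term contributes `1 / 4`
for two probability densities. -/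
lemma sqrt_mul_le_min_add {a b : ℝ} (ha : 0 ≤ a) (hb : 0 ≤ b) :
    √(a * b) ≤ 2 * min a b + (a + b) / 8 := by
  wlog hab : a ≤ b generalizing a b
  · rw [mul_comm, min_comm, add_comm a b]
    exact this hb ha (le_of_not_ge hab)
  rw [min_eq_left hab]
  apply Real.sqrt_le_iff.2
  constructor
  · positivity
  · nlinarith [sq_nonneg (2 * a - b / 8)]

/-- The affinity `∫ √(p q)` bounds the overlap of two product densities from below. -/
lemma affinity_pow_le {μ : Measure E} [SigmaFinite μ] {p q : E → ℝ} (hp : Measurable p)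
    (hq : Measurable q) (hp0 : ∀ x, 0 ≤ p x) (hq0 : ∀ x, 0 ≤ q x)
    (hp1 : ∫⁻ x, ENNReal.ofReal (p x) ∂μ = 1) (hq1 : ∫⁻ x, ENNReal.ofReal (q x) ∂μ = 1)
    (N : ℕ) :
    (∫⁻ x, ENNReal.ofReal (√(p x * q x)) ∂μ) ^ N ≤
      2 * ∫⁻ X : Fin N → E, min (∏ i, ENNReal.ofReal (p (X i))) (∏ i, ENNReal.ofReal (q (X i)))
        ∂(Measure.pi fun _ => μ) + 1 / 4 := by
  have mP : Measurable fun X : Fin N → E => ∏ i, ENNReal.ofReal (p (X i)) :=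
    Finset.measurable_prod _ fun i _ => (hp.comp (measurable_pi_apply i)).ennreal_ofReal
  have mQ : Measurable fun X : Fin N → E => ∏ i, ENNReal.ofReal (q (X i)) :=
    Finset.measurable_prod _ fun i _ => (hq.comp (measurable_pi_apply i)).ennreal_ofReal
  have iP : ∫⁻ X : Fin N → E, ∏ i, ENNReal.ofReal (p (X i)) ∂(Measure.pi fun _ => μ) = 1 := by
    rw [lintegral_pi_prod μ (fun _ x => ENNReal.ofReal (p x)) fun _ => hp.ennreal_ofReal]
    simp [hp1]
  have iQ : ∫⁻ X : Fin N → E, ∏ i, ENNReal.ofReal (q (X i)) ∂(Measure.pi fun _ => μ) = 1 := by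
    rw [lintegral_pi_prod μ (fun _ x => ENNReal.ofReal (q x)) fun _ => hq.ennreal_ofReal]
    simp [hq1]
  -- The affinity is multiplicative over independent samples.
  have e := lintegral_pi_prod (N := N) μ (fun _ x => ENNReal.ofReal (√(p x * q x)))
    fun _ => (hp.mul hq).sqrt.ennreal_ofReal
  rw [Finset.prod_const, Finset.card_univ, Fintype.card_fin] at e
  rw [← e]
  calc _ ≤ ∫⁻ X : Fin N → E, (2 * min (∏ i, ENNReal.ofReal (p (X i)))
        (∏ i, ENNReal.ofReal (q (X i))) + ENNReal.ofReal (1 / 8) *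
        (∏ i, ENNReal.ofReal (p (X i)) + ∏ i, ENNReal.ofReal (q (X i))))
        ∂(Measure.pi fun _ => μ) := by
        refine lintegral_mono fun X => ?_
        have hP0 : 0 ≤ ∏ i, p (X i) := Finset.prod_nonneg fun i _ => hp0 _
        have hQ0 : 0 ≤ ∏ i, q (X i) := Finset.prod_nonneg fun i _ => hq0 _
        rw [← ENNReal.ofReal_prod_of_nonneg fun i _ => hp0 _,
          ← ENNReal.ofReal_prod_of_nonneg fun i _ => hq0 _,
          ← ENNReal.ofReal_prod_of_nonneg fun i _ => Real.sqrt_nonneg _,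
          ← ENNReal.ofReal_min, show (2 : ℝ≥0∞) = ENNReal.ofReal 2 by norm_num,
          ← ENNReal.ofReal_mul zero_le_two, ← ENNReal.ofReal_add hP0 hQ0,
          ← ENNReal.ofReal_mul (by norm_num), ← ENNReal.ofReal_add
          (by positivity) (by positivity)]
        apply ENNReal.ofReal_le_ofReal
        rw [← Real.sqrt_prod _ fun i _ => mul_nonneg (hp0 _) (hq0 _), Finset.prod_mul_distrib]
        refine (sqrt_mul_le_min_add hP0 hQ0).trans (le_of_eq ?_)
        ring
    _ = _ := by
        rw [lintegral_add_left ((mP.min mQ).const_mul _), lintegral_const_mul _ (mP.min mQ),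
          lintegral_const_mul' _ _ ENNReal.ofReal_ne_top, lintegral_add_left mP, iP, iQ, one_add_one_eq_two]
        congr 1
        rw [show (2 : ℝ≥0∞) = ENNReal.ofReal 2 by norm_num, ← ENNReal.ofReal_mul (by norm_num),
          ← ENNReal.ofReal_one, show (4 : ℝ≥0∞) = ENNReal.ofReal 4 by norm_num,
          ← ENNReal.ofReal_div_of_pos (by norm_num)]
        norm_num

/-- Two hypotheses whose product laws overlap cannot both be estimated well on a set where they
differ. -/
lemma overlap_mul_le_add {μ : Measure E} [SigmaFinite μ] {p q : E → ℝ} (hp : Measurable p)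
    (hq : Measurable q)
    (hp1 : ∫⁻ x, ENNReal.ofReal (p x) ∂μ = 1) (hq1 : ∫⁻ x, ENNReal.ofReal (q x) ∂μ = 1)
    {N : ℕ} {est : (Fin N → E) → E → ℝ} (hest : Measurable (Function.uncurry est)) (B : Set E) :
    (∫⁻ X : Fin N → E, min (∏ i, ENNReal.ofReal (p (X i))) (∏ i, ENNReal.ofReal (q (X i)))
        ∂(Measure.pi fun _ => μ)) * ∫⁻ x in B, ‖p x - q x‖ₑ ∂μ ≤
      ∫⁻ X, (∫⁻ x in B, ‖est X x - p x‖ₑ ∂μ)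
          ∂(Measure.pi fun _ : Fin N => μ.withDensity fun x => ENNReal.ofReal (p x)) +
        ∫⁻ X, (∫⁻ x in B, ‖est X x - q x‖ₑ ∂μ)
          ∂(Measure.pi fun _ : Fin N => μ.withDensity fun x => ENNReal.ofReal (q x)) := by
  have hfin : ∀ g : E → ℝ, ∫⁻ x, ENNReal.ofReal (g x) ∂μ = 1 →
      IsProbabilityMeasure (μ.withDensity fun x => ENNReal.ofReal (g x)) := fun g h =>
    ⟨by rw [withDensity_apply _ MeasurableSet.univ, setLIntegral_univ, h]⟩
  have := hfin p hp1
  have := hfin q hq1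
  have mP : Measurable fun X : Fin N → E => ∏ i, ENNReal.ofReal (p (X i)) :=
    Finset.measurable_prod _ fun i _ => (hp.comp (measurable_pi_apply i)).ennreal_ofReal
  have mQ : Measurable fun X : Fin N → E => ∏ i, ENNReal.ofReal (q (X i)) :=
    Finset.measurable_prod _ fun i _ => (hq.comp (measurable_pi_apply i)).ennreal_ofReal
  have mG : ∀ g : E → ℝ, Measurable g → Measurable fun X : Fin N → E =>
      ∫⁻ x in B, ‖est X x - g x‖ₑ ∂μ := fun g hg =>
    Measurable.lintegral_prod_right' (f := fun z : (Fin N → E) × E => ‖est z.1 z.2 - g z.2‖ₑ)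
      (hest.sub (hg.comp measurable_snd)).enorm
  rw [pi_withDensity μ hp.ennreal_ofReal, pi_withDensity μ hq.ennreal_ofReal,
    lintegral_withDensity_eq_lintegral_mul _ mP (mG p hp),
    lintegral_withDensity_eq_lintegral_mul _ mQ (mG q hq),
    ← lintegral_add_left (mP.mul (mG p hp)), ← lintegral_mul_const _ (mP.min mQ)]
  refine lintegral_mono fun X => ?_
  simp only [Pi.mul_apply]
  -- For each sample, the errors under the two hypotheses add up to at least the distance between
  -- them; weighting by the smaller of the two likelihoods gives the claim.
  have htri : ∫⁻ x in B, ‖p x - q x‖ₑ ∂μ ≤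
      ∫⁻ x in B, ‖est X x - p x‖ₑ ∂μ + ∫⁻ x in B, ‖est X x - q x‖ₑ ∂μ := by
    have mE : Measurable fun x => ‖est X x - p x‖ₑ :=
      ((hest.comp measurable_prodMk_left).sub hp).enorm
    rw [← lintegral_add_left mE]
    refine lintegral_mono fun x => ?_
    rw [show p x - q x = (est X x - q x) - (est X x - p x) by ring, add_comm]
    exact enorm_sub_le
  calc _ ≤ min (∏ i, ENNReal.ofReal (p (X i))) (∏ i, ENNReal.ofReal (q (X i))) *
        (∫⁻ x in B, ‖est X x - p x‖ₑ ∂μ + ∫⁻ x in B, ‖est X x - q x‖ₑ ∂μ) := by gcongr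
    _ ≤ _ := by
        rw [mul_add]
        gcongr
        · exact min_le_left _ _
        · exact min_le_right _ _

end Product

/-! ### Averaging over the hypercube of sign vectors. -/

section Assouad

/-- Flipping one coordinate of a sign vector. -/
def flipAt {J : Type*} [DecidableEq J] (j : J) (θ : J → Bool) : J → Bool :=
  Function.update θ j (!θ j)

lemma flipAt_involutive {J : Type*} [DecidableEq J] (j : J) :
    Function.Involutive (flipAt (J := J) j) := by
  intro θ
  simp [flipAt]

/-- If flipping the `j`-th sign costs at least `τ` in the `j`-th part of the risk, then the total
risk is at least `|J| τ / 2` for some sign vector. -/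
lemma assouad {J : Type*} [Fintype J] [DecidableEq J] {R : (J → Bool) → J → ℝ≥0∞}
    {τ W : ℝ≥0∞} (hτ : ∀ θ j, τ ≤ R θ j + R (flipAt j θ) j) (hW : ∀ θ, ∑ j, R θ j ≤ W) :
    Fintype.card J * τ ≤ 2 * W := by
  have hcard0 : ((Fintype.card (J → Bool) : ℕ) : ℝ≥0∞) ≠ 0 := by
    simp
  have h1 : ∀ j, (Fintype.card (J → Bool) : ℝ≥0∞) * τ ≤ 2 * ∑ θ, R θ j := by
    intro j
    -- Flipping permutes the sign vectors, so both terms of `hτ` have the same sum over `θ`.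
    have e : ∑ θ, R (flipAt j θ) j = ∑ θ, R θ j :=
      Equiv.sum_comp (flipAt_involutive j).toPerm fun θ => R θ j
    calc (Fintype.card (J → Bool) : ℝ≥0∞) * τ = ∑ _θ : J → Bool, τ := by
          rw [Finset.sum_const, Finset.card_univ, nsmul_eq_mul]
      _ ≤ ∑ θ, (R θ j + R (flipAt j θ) j) := Finset.sum_le_sum fun θ _ => hτ θ j
      _ = _ := by rw [Finset.sum_add_distrib, e, two_mul]
  have h2 : (Fintype.card (J → Bool) : ℝ≥0∞) * (Fintype.card J * τ) ≤
      Fintype.card (J → Bool) * (2 * W) := by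
    calc _ = ∑ _j : J, (Fintype.card (J → Bool) : ℝ≥0∞) * τ := by
          rw [Finset.sum_const, Finset.card_univ, nsmul_eq_mul]; ring
      _ ≤ ∑ j, 2 * ∑ θ, R θ j := Finset.sum_le_sum fun j _ => h1 j
      _ = 2 * ∑ θ, ∑ j, R θ j := by rw [← Finset.mul_sum, Finset.sum_comm]
      _ ≤ 2 * ∑ _θ : J → Bool, W := by gcongr with θ; exact hW θ
      _ = _ := by rw [Finset.sum_const, Finset.card_univ, nsmul_eq_mul]; ring
  exact (ENNReal.mul_le_mul_iff_right hcard0 (ENNReal.natCast_ne_top _)).1 h2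

end Assouad

/-! ### Tents and perturbed uniform densities. -/

section Tent

variable {d : ℕ}

/-- The tent of slope one over the ball of radius `r` around `c`. -/
noncomputable def tent (r : ℝ) (c x : EuclideanSpace ℝ (Fin d)) : ℝ := max 0 (r - dist x c)

lemma tent_nonneg (r : ℝ) (c x : EuclideanSpace ℝ (Fin d)) : 0 ≤ tent r c x := le_max_left _ _

lemma tent_le {r : ℝ} (hr : 0 ≤ r) (c x : EuclideanSpace ℝ (Fin d)) : tent r c x ≤ r :=
  max_le hr (by linarith [dist_nonneg (x := x) (y := c)])

lemma tent_eq_zero {r : ℝ} {c x : EuclideanSpace ℝ (Fin d)} (h : r ≤ dist x c) :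
    tent r c x = 0 := max_eq_left (by linarith)

lemma dist_lt_of_tent_ne_zero {r : ℝ} {c x : EuclideanSpace ℝ (Fin d)} (h : tent r c x ≠ 0) :
    dist x c < r := by
  by_contra h'
  exact h (tent_eq_zero (not_lt.1 h'))

lemma continuous_tent (r : ℝ) (c : EuclideanSpace ℝ (Fin d)) : Continuous (tent r c) := by
  unfold tent; fun_prop

lemma abs_tent_sub_le (r : ℝ) (c x y : EuclideanSpace ℝ (Fin d)) :
    |tent r c x - tent r c y| ≤ dist x y := by
  unfold tent
  refine (abs_max_sub_max_le_max _ _ _ _).trans (max_le (by simp) ?_)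
  rw [show r - dist x c - (r - dist y c) = dist y c - dist x c by ring, dist_comm x y]
  exact abs_dist_sub_le y x c

lemma integrable_tent (r : ℝ) (c : EuclideanSpace ℝ (Fin d)) : Integrable (tent r c) := by
  refine (continuous_tent r c).integrable_of_hasCompactSupport ?_
  refine HasCompactSupport.intro (isCompact_closedBall c r) fun x hx => tent_eq_zero ?_
  exact (not_le.1 hx).le

lemma integral_tent_eq (r : ℝ) (c : EuclideanSpace ℝ (Fin d)) :
    ∫ x, tent r c x = ∫ x, tent r (0 : EuclideanSpace ℝ (Fin d)) x := by
  rw [← integral_add_right_eq_self (tent r c) c]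
  simp [tent]

variable {K : Type*} [Fintype K] {r : ℝ} {c : K → EuclideanSpace ℝ (Fin d)}

/-- A signed sum of tents. -/
noncomputable def tentSum (r : ℝ) (c : K → EuclideanSpace ℝ (Fin d)) (ε : K → ℝ)
    (x : EuclideanSpace ℝ (Fin d)) : ℝ := ∑ κ, ε κ * tent r (c κ) x

lemma card_tent_ne_zero_le (hc : ∀ κ κ', κ ≠ κ' → 2 * r ≤ dist (c κ) (c κ'))
    (x : EuclideanSpace ℝ (Fin d)) :
    (Finset.univ.filter fun κ => tent r (c κ) x ≠ 0).card ≤ 1 := by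
  rw [Finset.card_le_one]
  intro a ha b hb
  by_contra hab
  have h1 := dist_lt_of_tent_ne_zero (Finset.mem_filter.1 ha).2
  have h2 := dist_lt_of_tent_ne_zero (Finset.mem_filter.1 hb).2
  have h3 := hc a b hab
  have h4 := dist_triangle_left (c a) (c b) x
  linarith

lemma abs_tentSum_le (hr : 0 ≤ r) (hc : ∀ κ κ', κ ≠ κ' → 2 * r ≤ dist (c κ) (c κ')) {ε : K → ℝ}
    (hε : ∀ κ, |ε κ| ≤ 1) (x : EuclideanSpace ℝ (Fin d)) : |tentSum r c ε x| ≤ r := by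
  calc |tentSum r c ε x| ≤ ∑ κ, |ε κ * tent r (c κ) x| := Finset.abs_sum_le_sum_abs _ _
    _ ≤ ∑ κ, tent r (c κ) x := Finset.sum_le_sum fun κ _ => by
        rw [abs_mul, abs_of_nonneg (tent_nonneg _ _ _)]
        exact mul_le_of_le_one_left (tent_nonneg _ _ _) (hε κ)
    _ = ∑ κ ∈ Finset.univ.filter fun κ => tent r (c κ) x ≠ 0, tent r (c κ) x :=
        (Finset.sum_filter_ne_zero _).symm
    _ ≤ (Finset.univ.filter fun κ => tent r (c κ) x ≠ 0).card • r :=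
        Finset.sum_le_card_nsmul _ _ _ fun κ _ => tent_le hr _ _
    _ ≤ 1 • r := by gcongr; exact card_tent_ne_zero_le hc x
    _ = r := one_smul _ _

/-- At most one tent is nonzero at `x` and one at `y`, so only two terms of slope one contribute. -/
lemma abs_tentSum_sub_le (hc : ∀ κ κ', κ ≠ κ' → 2 * r ≤ dist (c κ) (c κ')) {ε : K → ℝ}
    (hε : ∀ κ, |ε κ| ≤ 1) (x y : EuclideanSpace ℝ (Fin d)) :
    |tentSum r c ε x - tentSum r c ε y| ≤ 2 * dist x y := by
  classical
  let A := (Finset.univ.filter fun κ => tent r (c κ) x ≠ 0) ∪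
    (Finset.univ.filter fun κ => tent r (c κ) y ≠ 0)
  have hA : A.card ≤ 2 := (Finset.card_union_le _ _).trans
    (add_le_add (card_tent_ne_zero_le hc x) (card_tent_ne_zero_le hc y))
  have e : tentSum r c ε x - tentSum r c ε y =
      ∑ κ ∈ A, ε κ * (tent r (c κ) x - tent r (c κ) y) := by
    rw [tentSum, tentSum, ← Finset.sum_sub_distrib]
    symm
    refine (Finset.sum_subset (Finset.subset_univ A) fun κ _ hκ => ?_).trans
      (Finset.sum_congr rfl fun κ _ => mul_sub _ _ _)
    simp only [A, Finset.mem_union, Finset.mem_filter, Finset.mem_univ, true_and, not_or,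
      not_not] at hκ
    rw [hκ.1, hκ.2, sub_zero, mul_zero]
  rw [e]
  calc _ ≤ ∑ κ ∈ A, |ε κ * (tent r (c κ) x - tent r (c κ) y)| := Finset.abs_sum_le_sum_abs _ _
    _ ≤ A.card • dist x y := Finset.sum_le_card_nsmul _ _ _ fun κ _ => by
        rw [abs_mul]
        exact (mul_le_of_le_one_left (abs_nonneg _) (hε κ)).trans (abs_tent_sub_le _ _ _ _)
    _ ≤ 2 • dist x y := by gcongr
    _ = _ := by rw [nsmul_eq_mul]; norm_num

lemma continuous_tentSum (r : ℝ) (c : K → EuclideanSpace ℝ (Fin d)) (ε : K → ℝ) :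
    Continuous (tentSum r c ε) :=
  continuous_finsetSum _ fun κ _ => continuous_const.mul (continuous_tent r (c κ))

lemma integrable_tentSum (r : ℝ) (c : K → EuclideanSpace ℝ (Fin d)) (ε : K → ℝ) :
    Integrable (tentSum r c ε) :=
  integrable_finsetSum _ fun κ _ => (integrable_tent r (c κ)).const_mul _

/-- All tents have the same integral by translation, so balanced signs cancel. -/
lemma integral_tentSum (r : ℝ) (c : K → EuclideanSpace ℝ (Fin d)) {ε : K → ℝ}
    (hε : ∑ κ, ε κ = 0) : ∫ x, tentSum r c ε x = 0 := by
  unfold tentSum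
  rw [integral_finsetSum _ fun κ _ => (integrable_tent r (c κ)).const_mul _]
  simp_rw [integral_const_mul, integral_tent_eq r (c _)]
  rw [← Finset.sum_mul, hε, zero_mul]

/-- A perturbation of the uniform density on `S` by signed tents. -/
noncomputable def perturbedDensity (S : Set (EuclideanSpace ℝ (Fin d))) (r : ℝ)
    (c : K → EuclideanSpace ℝ (Fin d)) (ε : K → ℝ) : EuclideanSpace ℝ (Fin d) → ℝ :=
  S.indicator fun x => (volume S).toReal⁻¹ * (1 + tentSum r c ε x)

variable {S : Set (EuclideanSpace ℝ (Fin d))}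

lemma lintegral_perturbedDensity (hS : MeasurableSet S) (hS0 : volume S ≠ 0)
    (hSfin : volume S ≠ ∞) (hr : 0 ≤ r) (hr1 : r ≤ 1)
    (hc : ∀ κ κ', κ ≠ κ' → 2 * r ≤ dist (c κ) (c κ'))
    (hcS : ∀ κ, Metric.closedBall (c κ) r ⊆ S) {ε : K → ℝ} (hε : ∀ κ, |ε κ| ≤ 1)
    (hε0 : ∑ κ, ε κ = 0) :
    ∫⁻ x, ENNReal.ofReal (perturbedDensity S r c ε x) = 1 := by
  have hv : 0 < (volume S).toReal := ENNReal.toReal_pos hS0 hSfin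
  have hint : IntegrableOn (fun x => (volume S).toReal⁻¹ * (1 + tentSum r c ε x)) S :=
    ((integrableOn_const hSfin).add (integrable_tentSum r c ε).integrableOn).const_mul _
  have h0 : ∀ x, 0 ≤ perturbedDensity S r c ε x := fun x =>
    indicator_nonneg (fun x _ => mul_nonneg (inv_nonneg.2 hv.le) (by
      linarith [(abs_le.1 (abs_tentSum_le hr hc hε x)).1])) x
  rw [← ofReal_integral_eq_lintegral_ofReal (f := perturbedDensity S r c ε) (hint.integrable_indicator hS)
    (Filter.Eventually.of_forall h0)]
  have e1 : ∫ x in S, tentSum r c ε x = 0 := by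
    rw [setIntegral_eq_integral_of_forall_compl_eq_zero, integral_tentSum r c hε0]
    intro x hx
    refine Finset.sum_eq_zero fun κ _ => ?_
    rw [tent_eq_zero, mul_zero]
    by_contra h
    exact hx (hcS κ (not_le.1 h).le)
  have : ∫ x, perturbedDensity S r c ε x = 1 := by
    unfold perturbedDensity
    have h1 : IntegrableOn (fun _ : EuclideanSpace ℝ (Fin d) => (1 : ℝ)) S :=
      integrableOn_const hSfin
    rw [integral_indicator hS, integral_const_mul, integral_add h1
      (integrable_tentSum r c ε).integrableOn, e1, setIntegral_const]
    simp only [smul_eq_mul, mul_one, add_zero, measureReal_def]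
    exact inv_mul_cancel₀ hv.ne'
  rw [this, ENNReal.ofReal_one]

/-- The tents have slope one and sum to at most `1 / 2` in absolute value, so the bounds on `m`, `M`
and `L` depend only on the volume of `S`, and not on `r` or the number of tents. -/
lemma isBoundedSupportDensity_perturbedDensity {m M L : ℝ} {CS : ℝ≥0}
    (hSb : Bornology.IsBounded S) (hS : MeasurableSet S) (hS0 : volume S ≠ 0)
    (hSC : μH[(d : ℝ) - 1] (frontier S) ≤ (CS : ℝ≥0∞))
    (hr : 0 ≤ r) (hr1 : r ≤ 1 / 2)
    (hc : ∀ κ κ', κ ≠ κ' → 2 * r ≤ dist (c κ) (c κ'))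
    (hcS : ∀ κ, Metric.closedBall (c κ) r ⊆ S) {ε : K → ℝ} (hε : ∀ κ, |ε κ| ≤ 1)
    (hε0 : ∑ κ, ε κ = 0) (hm : m ≤ (volume S).toReal⁻¹ / 2) (hM : 2 * (volume S).toReal⁻¹ ≤ M)
    (hL : 2 * (volume S).toReal⁻¹ ≤ L) :
    IsBoundedSupportDensity d m M L CS S (perturbedDensity S r c ε) := by
  have hSfin : volume S ≠ ∞ := hSb.measure_lt_top.ne
  have hv : 0 < (volume S).toReal⁻¹ := inv_pos.2 (ENNReal.toReal_pos hS0 hSfin)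
  have hb := fun x => abs_le.1 (abs_tentSum_le hr hc hε x)
  refine ⟨hSb, ?_, fun x hx => indicator_of_notMem hx _,
    lintegral_perturbedDensity hS hS0 hSfin hr (by linarith) hc hcS hε hε0, ?_, ?_, ?_, hSC⟩
  · exact ((measurable_const.add (continuous_tentSum r c ε).measurable).const_mul _).indicator hS
  · intro x hx
    rw [perturbedDensity, indicator_of_mem hx]
    nlinarith [(hb x).1]
  · intro x hx
    rw [perturbedDensity, indicator_of_mem hx]
    nlinarith [(hb x).2]
  · intro x hx y hy
    rw [perturbedDensity, indicator_of_mem hx, indicator_of_mem hy, ← mul_sub,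
      add_sub_add_left_eq_sub, abs_mul, abs_of_pos hv, ← dist_eq_norm]
    have := abs_tentSum_sub_le hc hε x y
    calc _ ≤ (volume S).toReal⁻¹ * (2 * dist x y) := by gcongr
      _ = 2 * (volume S).toReal⁻¹ * dist x y := by ring
      _ ≤ _ := by gcongr

end Tent

/-! ### Cost of one sign flip and the resulting bound on the worst risk. -/

section LowerBound

variable {d : ℕ}

/-- The gap between the two means is `(√a - √b)² / 2`, and `(a - b)² = (√a - √b)² (√a + √b)²` with
`(√a + √b)² ≥ 4 a₀`. -/
lemma add_div_two_le_sqrt_mul_add {a b a₀ : ℝ} (h0 : 0 < a₀) (ha : a₀ ≤ a) (hb : a₀ ≤ b) :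
    (a + b) / 2 ≤ √(a * b) + (a - b) ^ 2 / (8 * a₀) := by
  have ha0 : 0 ≤ a := h0.le.trans ha
  have hb0 : 0 ≤ b := h0.le.trans hb
  rw [Real.sqrt_mul ha0]
  have h1 := Real.sq_sqrt ha0
  have h2 := Real.sq_sqrt hb0
  have h3 : a₀ ≤ √a * √b := by
    rw [← Real.sqrt_mul ha0]
    exact Real.le_sqrt_of_sq_le (by nlinarith)
  have h4 : (√a - √b) ^ 2 / 2 ≤ (a - b) ^ 2 / (8 * a₀) := by
    rw [div_le_div_iff₀ two_pos (by positivity)]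
    have e : (a - b) ^ 2 = (√a - √b) ^ 2 * (√a + √b) ^ 2 := by
      rw [← h1, ← h2]; simp only [Real.sqrt_sq (Real.sqrt_nonneg _)]; ring
    have h5 : 4 * a₀ ≤ (√a + √b) ^ 2 := by nlinarith
    rw [e]
    nlinarith [mul_le_mul_of_nonneg_left h5 (sq_nonneg (√a - √b))]
  nlinarith

lemma one_le_affinity_add {E : Type*} [MeasurableSpace E] {μ : Measure E} {p q : E → ℝ}
    (hp : Measurable p) (hq : Measurable q) (hp0 : ∀ x, 0 ≤ p x) (hq0 : ∀ x, 0 ≤ q x)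
    (hp1 : ∫⁻ x, ENNReal.ofReal (p x) ∂μ = 1) (hq1 : ∫⁻ x, ENNReal.ofReal (q x) ∂μ = 1)
    {U : Set E} (hU : MeasurableSet U) {a₀ η : ℝ} (ha₀ : 0 < a₀)
    (hpU : ∀ x ∈ U, a₀ ≤ p x) (hqU : ∀ x ∈ U, a₀ ≤ q x) (hη : ∀ x ∈ U, |p x - q x| ≤ η)
    (heq : ∀ x ∉ U, p x = q x) :
    1 ≤ ∫⁻ x, ENNReal.ofReal (√(p x * q x)) ∂μ + ENNReal.ofReal (η ^ 2 / (8 * a₀)) * μ U := by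
  have e : ∫⁻ x, ENNReal.ofReal ((p x + q x) / 2) ∂μ = 1 := by
    have : ∀ x, ENNReal.ofReal ((p x + q x) / 2) =
        ENNReal.ofReal (1 / 2) * (ENNReal.ofReal (p x) + ENNReal.ofReal (q x)) := fun x => by
      rw [← ENNReal.ofReal_add (hp0 x) (hq0 x), ← ENNReal.ofReal_mul (by norm_num)]
      congr 1; ring
    simp_rw [this]
    rw [lintegral_const_mul' _ _ ENNReal.ofReal_ne_top, lintegral_add_left hp.ennreal_ofReal,
      hp1, hq1, one_add_one_eq_two, show (2 : ℝ≥0∞) = ENNReal.ofReal 2 by norm_num,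
      ← ENNReal.ofReal_mul (by norm_num)]
    norm_num
  have hpq : Measurable fun x => ENNReal.ofReal (√(p x * q x)) :=
    (hp.mul hq).sqrt.ennreal_ofReal
  rw [← e, ← setLIntegral_const, ← lintegral_indicator hU, ← lintegral_add_left hpq]
  refine lintegral_mono fun x => ?_
  by_cases hx : x ∈ U
  · rw [indicator_of_mem hx, ← ENNReal.ofReal_add (Real.sqrt_nonneg _) (by positivity)]
    apply ENNReal.ofReal_le_ofReal
    refine (add_div_two_le_sqrt_mul_add ha₀ (hpU x hx) (hqU x hx)).trans ?_
    have : (p x - q x) ^ 2 ≤ η ^ 2 := by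
      rw [← sq_abs]; gcongr; exact hη x hx
    gcongr
  · rw [indicator_of_notMem hx, add_zero, heq x hx, Real.sqrt_mul_self (hq0 x), add_self_div_two]

/-- By Bernoulli's inequality `B ^ N ≥ 1 - N a ≥ 1 / 2`, so `2 I ≥ 1 / 4`. -/
lemma one_eighth_le_of_affinity {B I : ℝ≥0∞} {a : ℝ} {N : ℕ} (ha : 0 ≤ a) (ha1 : a ≤ 1)
    (hNa : N * a ≤ 1 / 2) (hB : 1 ≤ B + ENNReal.ofReal a) (hI : B ^ N ≤ 2 * I + 1 / 4) :
    ENNReal.ofReal (1 / 8) ≤ I := by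
  rcases eq_or_ne I ∞ with rfl | hItop
  · exact le_top
  have h1 : ENNReal.ofReal (1 - a) ≤ B := by
    rw [ENNReal.ofReal_sub _ ha, ENNReal.ofReal_one]
    exact tsub_le_iff_right.2 hB
  have h2 : ENNReal.ofReal (1 / 2) ≤ B ^ N := by
    calc ENNReal.ofReal (1 / 2) ≤ ENNReal.ofReal ((1 - a) ^ N) := by
          apply ENNReal.ofReal_le_ofReal
          have := one_add_mul_le_pow (a := -a) (by linarith) N
          rw [← sub_eq_add_neg] at this
          linarith
      _ = ENNReal.ofReal (1 - a) ^ N := ENNReal.ofReal_pow (by linarith) N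
      _ ≤ B ^ N := by gcongr
  have h3 := h2.trans hI
  lift I to ℝ≥0 using hItop
  have h4 : (2 * (I : ℝ≥0∞) + 1 / 4) = ENNReal.ofReal (2 * (I : ℝ) + 1 / 4) := by
    rw [ENNReal.ofReal_add (by positivity) (by norm_num), ENNReal.ofReal_mul zero_le_two,
      ENNReal.ofReal_coe_nnreal, ENNReal.ofReal_div_of_pos (by norm_num)]
    norm_num
  rw [h4, ENNReal.ofReal_le_ofReal_iff (by positivity)] at h3
  rw [← ENNReal.ofReal_coe_nnreal (p := I)]
  apply ENNReal.ofReal_le_ofReal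
  linarith

/-- The sign `±1` attached to a Boolean. -/
def boolSign (b : Bool) : ℝ := if b then 1 else -1

lemma abs_boolSign (b : Bool) : |boolSign b| = 1 := by cases b <;> simp [boolSign]

lemma boolSign_not (b : Bool) : boolSign (!b) = -boolSign b := by cases b <;> simp [boolSign]

/-- The signs of the two tents attached to each index. -/
def pairSign {J : Type*} (θ : J → Bool) (κ : J × Bool) : ℝ := boolSign (θ κ.1) * boolSign κ.2

lemma abs_pairSign {J : Type*} (θ : J → Bool) (κ : J × Bool) : |pairSign θ κ| ≤ 1 := by
  rw [pairSign, abs_mul, abs_boolSign, abs_boolSign, one_mul]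

/-- The reason for using tents in pairs: total mass is one for every choice of `θ`, so the signs can
be flipped independently. -/
lemma sum_pairSign {J : Type*} [Fintype J] (θ : J → Bool) : ∑ κ, pairSign θ κ = 0 := by
  rw [Fintype.sum_prod_type]
  refine Finset.sum_eq_zero fun j _ => ?_
  simp [pairSign, boolSign]

/-- The density attached to a sign vector. -/
noncomputable def signDensity {J : Type*} [Fintype J] (S : Set (EuclideanSpace ℝ (Fin d)))
    (r : ℝ) (c : J × Bool → EuclideanSpace ℝ (Fin d)) (θ : J → Bool) :
    EuclideanSpace ℝ (Fin d) → ℝ :=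
  perturbedDensity S r c (pairSign θ)

variable {J : Type*} [Fintype J] [DecidableEq J] {r : ℝ}
  {c : J × Bool → EuclideanSpace ℝ (Fin d)} {S : Set (EuclideanSpace ℝ (Fin d))}

lemma tentSum_sub_flipAt (θ : J → Bool) (j : J) (x : EuclideanSpace ℝ (Fin d)) :
    tentSum r c (pairSign θ) x - tentSum r c (pairSign (flipAt j θ)) x =
      2 * boolSign (θ j) * (tent r (c (j, true)) x - tent r (c (j, false)) x) := by
  rw [tentSum, tentSum, ← Finset.sum_sub_distrib, Fintype.sum_prod_type,
    Finset.sum_eq_single j]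
  · simp only [Fintype.sum_bool, pairSign, flipAt, Function.update_self, boolSign_not]
    simp only [boolSign]
    simp only [if_true, Bool.false_eq_true, if_false]
    ring
  · intro i _ hij
    simp [pairSign, flipAt, Function.update_of_ne hij]
  · simp

lemma signDensity_sub_flipAt (hcS : ∀ κ, Metric.closedBall (c κ) r ⊆ S)
    (θ : J → Bool) (j : J) (x : EuclideanSpace ℝ (Fin d)) :
    signDensity S r c θ x - signDensity S r c (flipAt j θ) x =
      (volume S).toReal⁻¹ *
        (2 * boolSign (θ j) * (tent r (c (j, true)) x - tent r (c (j, false)) x)) := by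
  unfold signDensity perturbedDensity
  by_cases hx : x ∈ S
  · rw [indicator_of_mem hx, indicator_of_mem hx, ← mul_sub, add_sub_add_left_eq_sub,
      tentSum_sub_flipAt]
  · have h0 : ∀ κ, tent r (c κ) x = 0 := fun κ => tent_eq_zero (by
      by_contra h
      exact hx (hcS κ (not_le.1 h).le))
    rw [indicator_of_notMem hx, indicator_of_notMem hx, h0, h0]
    ring

/-- Flipping one sign costs at least a fixed amount of risk near the corresponding tent. -/
lemma le_pair_risk (hSb : Bornology.IsBounded S) (hS : MeasurableSet S)
    (hS0 : volume S ≠ 0) (hr : 0 < r) (hr1 : r ≤ 1 / 2)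
    (hc : ∀ κ κ', κ ≠ κ' → 2 * r ≤ dist (c κ) (c κ'))
    (hcS : ∀ κ, Metric.closedBall (c κ) r ⊆ S) {N : ℕ} (hN : 1 ≤ N)
    (hNr : N * (2 * unitBallVolume d * (volume S).toReal⁻¹ * r ^ (d + 2)) ≤ 1 / 2)
    {est : (Fin N → EuclideanSpace ℝ (Fin d)) → EuclideanSpace ℝ (Fin d) → ℝ}
    (hest : Measurable (Function.uncurry est)) (θ : J → Bool) (j : J) :
    ENNReal.ofReal (1 / 8 * ((volume S).toReal⁻¹ * r * (unitBallVolume d * (r / 2) ^ d))) ≤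
      ∫⁻ X, (∫⁻ x in Metric.closedBall (c (j, true)) (r / 2), ‖est X x - signDensity S r c θ x‖ₑ)
          ∂(Measure.pi fun _ : Fin N =>
            volume.withDensity fun x => ENNReal.ofReal (signDensity S r c θ x)) +
        ∫⁻ X, (∫⁻ x in Metric.closedBall (c (j, true)) (r / 2),
            ‖est X x - signDensity S r c (flipAt j θ) x‖ₑ)
          ∂(Measure.pi fun _ : Fin N =>
            volume.withDensity fun x => ENNReal.ofReal (signDensity S r c (flipAt j θ) x)) := by
  have hSfin : volume S ≠ ∞ := hSb.measure_lt_top.ne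
  have hv : 0 < (volume S).toReal⁻¹ := inv_pos.2 (ENNReal.toReal_pos hS0 hSfin)
  have hκ := unitBallVolume_pos d
  set v := (volume S).toReal⁻¹ with hvdef
  have hmeas : ∀ θ : J → Bool, Measurable (signDensity S r c θ) := fun θ =>
    ((measurable_const.add (continuous_tentSum r c (pairSign θ)).measurable).const_mul
      v).indicator hS
  have hint : ∀ θ : J → Bool, ∫⁻ x, ENNReal.ofReal (signDensity S r c θ x) = 1 := fun θ =>
    lintegral_perturbedDensity hS hS0 hSfin hr.le (by linarith) hc hcS (abs_pairSign θ)
      (sum_pairSign θ)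
  have hlow : ∀ (θ : J → Bool), ∀ x ∈ S, v / 2 ≤ signDensity S r c θ x := fun θ x hx => by
    rw [signDensity, perturbedDensity, indicator_of_mem hx]
    nlinarith [(abs_le.1 (abs_tentSum_le hr.le hc (abs_pairSign θ) x)).1]
  have hnn : ∀ (θ : J → Bool) x, 0 ≤ signDensity S r c θ x := fun θ x => by
    by_cases hx : x ∈ S
    · exact le_trans (by positivity) (hlow θ x hx)
    · rw [signDensity, perturbedDensity, indicator_of_notMem hx]
  set p := signDensity S r c θ with hp
  set q := signDensity S r c (flipAt j θ) with hq
  have hsub : ∀ x, p x - q x = v *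
      (2 * boolSign (θ j) * (tent r (c (j, true)) x - tent r (c (j, false)) x)) :=
    signDensity_sub_flipAt hcS θ j
  have habs : ∀ x, |p x - q x| =
      2 * v * |tent r (c (j, true)) x - tent r (c (j, false)) x| := fun x => by
    rw [hsub, abs_mul, abs_mul, abs_mul, abs_boolSign, abs_of_pos hv, abs_two]; ring
  let U := Metric.closedBall (c (j, true)) r ∪ Metric.closedBall (c (j, false)) r
  have hUm : MeasurableSet U :=
    Metric.isClosed_closedBall.measurableSet.union Metric.isClosed_closedBall.measurableSet
  have hUS : U ⊆ S := union_subset (hcS _) (hcS _)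
  have hUvol : volume U ≤ ENNReal.ofReal (2 * (unitBallVolume d * r ^ d)) := by
    refine (measure_union_le _ _).trans (le_of_eq ?_)
    rw [volume_closedBall_eq _ hr.le, volume_closedBall_eq _ hr.le, ← two_mul,
      ENNReal.ofReal_mul zero_le_two, ENNReal.ofReal_ofNat]
  -- The densities are at least `v / 2` on `S` and differ by at most `2 v r`, only on two balls of
  -- radius `r`; hence the affinity loss of order `r ^ (d + 2)`.
  have haff := one_le_affinity_add (μ := volume) (hmeas θ) (hmeas (flipAt j θ)) (hnn θ) (hnn _)
    (hint θ) (hint _) hUm (a₀ := v / 2) (η := 2 * v * r) (by positivity)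
    (fun x hx => hlow θ x (hUS hx)) (fun x hx => hlow _ x (hUS hx))
    (fun x _ => by
      change |p x - q x| ≤ _
      rw [habs]
      gcongr
      rw [abs_le]
      constructor <;> linarith [tent_nonneg r (c (j, true)) x, tent_nonneg r (c (j, false)) x,
        tent_le hr.le (c (j, true)) x, tent_le hr.le (c (j, false)) x])
    (fun x hx => by
      change p x = q x
      have h1 : tent r (c (j, true)) x = 0 :=
        tent_eq_zero (not_le.1 fun h => hx (Or.inl h)).le
      have h2 : tent r (c (j, false)) x = 0 :=
        tent_eq_zero (not_le.1 fun h => hx (Or.inr h)).le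
      have := hsub x
      rw [h1, h2] at this
      linarith)
  have ha : ENNReal.ofReal ((2 * v * r) ^ 2 / (8 * (v / 2))) * volume U ≤
      ENNReal.ofReal (2 * unitBallVolume d * v * r ^ (d + 2)) := by
    calc _ ≤ ENNReal.ofReal ((2 * v * r) ^ 2 / (8 * (v / 2))) *
          ENNReal.ofReal (2 * (unitBallVolume d * r ^ d)) := by gcongr
      _ = _ := by
          rw [← ENNReal.ofReal_mul (by positivity)]
          congr 1
          field_simp
          ring
  have hN' : (1 : ℝ) ≤ N := by exact_mod_cast hN
  have ha0 : 0 ≤ 2 * unitBallVolume d * v * r ^ (d + 2) := by positivity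
  have hoverlap := one_eighth_le_of_affinity ha0 (by nlinarith) hNr
    (haff.trans (by gcongr))
    (affinity_pow_le (μ := volume) (hmeas θ) (hmeas (flipAt j θ)) (hnn θ) (hnn _) (hint θ)
      (hint _) N)
  refine le_trans ?_ (overlap_mul_le_add (μ := volume) (hmeas θ) (hmeas (flipAt j θ)) (hint θ)
    (hint _) hest (Metric.closedBall (c (j, true)) (r / 2)))
  rw [ENNReal.ofReal_mul (by norm_num)]
  refine mul_le_mul' hoverlap ?_
  rw [ENNReal.ofReal_mul (by positivity), ← volume_closedBall_eq (c (j, true)) (by positivity),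
    ← setLIntegral_const]
  -- On the ball of half the radius the tent is at least `r / 2` and its partner vanishes, so the
  -- two densities differ by at least `v r`.
  refine setLIntegral_mono' Metric.isClosed_closedBall.measurableSet fun x hx => ?_
  change _ ≤ ‖p x - q x‖ₑ
  rw [← ofReal_norm, Real.norm_eq_abs, habs]
  apply ENNReal.ofReal_le_ofReal
  rw [Metric.mem_closedBall] at hx
  have h2 : tent r (c (j, false)) x = 0 := by
    apply tent_eq_zero
    have h3 := hc (j, true) (j, false) (by simp)
    have h4 := dist_triangle_left (c (j, true)) (c (j, false)) x
    linarith
  have h1 : r / 2 ≤ tent r (c (j, true)) x := le_trans (by linarith) (le_max_right _ _)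
  rw [h2, sub_zero, abs_of_nonneg (tent_nonneg _ _ _)]
  nlinarith

/-- Lower bound for the worst risk of an estimator from a separated family of tents in `S`. -/
theorem card_mul_le_worstRisk {m M L : ℝ} {CS : ℝ≥0} (hSb : Bornology.IsBounded S)
    (hS : MeasurableSet S) (hS0 : volume S ≠ 0)
    (hSC : μH[(d : ℝ) - 1] (frontier S) ≤ (CS : ℝ≥0∞))
    (hm : m ≤ (volume S).toReal⁻¹ / 2) (hM : 2 * (volume S).toReal⁻¹ ≤ M)
    (hL : 2 * (volume S).toReal⁻¹ ≤ L) (hr : 0 < r) (hr1 : r ≤ 1 / 2)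
    (hc : ∀ κ κ', κ ≠ κ' → 2 * r ≤ dist (c κ) (c κ'))
    (hcS : ∀ κ, Metric.closedBall (c κ) r ⊆ S) {N : ℕ} (hN : 1 ≤ N)
    (hNr : N * (2 * unitBallVolume d * (volume S).toReal⁻¹ * r ^ (d + 2)) ≤ 1 / 2)
    {est : (Fin N → EuclideanSpace ℝ (Fin d)) → EuclideanSpace ℝ (Fin d) → ℝ}
    (hest : Measurable (Function.uncurry est)) :
    Fintype.card J *
        ENNReal.ofReal (1 / 8 * ((volume S).toReal⁻¹ * r * (unitBallVolume d * (r / 2) ^ d))) ≤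
      2 * worstRisk m M L CS S N est := by
  -- The `j`-th part of the risk is the error on the half-radius ball around `c (j, true)`. These
  -- balls are disjoint and lie in `S`, so the parts sum to at most the full risk.
  refine assouad (le_pair_risk hSb hS hS0 hr hr1 hc hcS hN hNr hest) fun θ => ?_
  have hcl := isBoundedSupportDensity_perturbedDensity (m := m) (M := M) (L := L) hSb hS hS0 hSC
    hr.le hr1 hc hcS (abs_pairSign θ) (sum_pairSign θ) hm hM hL
  refine le_trans ?_ (le_iSup₂ (f := fun f (_ : IsBoundedSupportDensity d m M L CS S f) =>
    l1Risk N S f est) (signDensity S r c θ) hcl)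
  have hmeas : Measurable (signDensity S r c θ) := hcl.measurable
  rw [← lintegral_finsetSum]
  · refine lintegral_mono fun X => ?_
    rw [← lintegral_biUnion_finset]
    · refine lintegral_mono_set (iUnion₂_subset fun j _ => ?_)
      exact (Metric.closedBall_subset_closedBall (by linarith)).trans (hcS _)
    · intro i _ j _ hij
      refine Metric.closedBall_disjoint_closedBall ?_
      have := hc (i, true) (j, true) (by simpa using hij)
      linarith
    · exact fun _ _ => Metric.isClosed_closedBall.measurableSet
  · intro j _
    exact Measurable.lintegral_prod_right'
      (f := fun z : (Fin N → EuclideanSpace ℝ (Fin d)) × EuclideanSpace ℝ (Fin d) =>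
        ‖est z.1 z.2 - signDensity S r c θ z.2‖ₑ)
      (hest.sub (hmeas.comp measurable_snd)).enorm

end LowerBound

/-! ### Placement of the tents, choice of the scale, and the final rates. -/

section Rates

variable {d : ℕ}

/-- A ball contains `2 n ^ d` disjoint balls of radius of order `1 / n`, with centres on a cubic
lattice. -/
lemma exists_separated_centers (hd : 1 ≤ d) (x₀ : EuclideanSpace ℝ (Fin d)) {R : ℝ} (hR : 0 < R)
    {n : ℕ} (hn : 1 ≤ n) :
    ∃ c : (Fin d → Fin n) × Bool → EuclideanSpace ℝ (Fin d),
      (∀ κ κ', κ ≠ κ' → 2 * (R / (8 * d) / n) ≤ dist (c κ) (c κ')) ∧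
      ∀ κ, Metric.closedBall (c κ) (R / (8 * d) / n) ⊆ Metric.ball x₀ R := by
  have hd' : (1 : ℝ) ≤ d := by exact_mod_cast hd
  have hn' : (1 : ℝ) ≤ n := by exact_mod_cast hn
  set r := R / (8 * d) / n with hr
  have hr0 : 0 < r := by positivity
  -- The Boolean is the common parity of all coordinates, so distinct indices give distinct integer
  -- vectors, with entries below `2 n`.
  let z : (Fin d → Fin n) × Bool → Fin d → ℤ :=
    fun κ i => 2 * ((κ.1 i : ℕ) : ℤ) + if κ.2 then 1 else 0
  let a : (Fin d → Fin n) × Bool → EuclideanSpace ℝ (Fin d) :=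
    fun κ => WithLp.toLp 2 fun i => 2 * r * (z κ i : ℝ)
  refine ⟨fun κ => x₀ + a κ, ?_, ?_⟩
  · intro κ κ' hne
    obtain ⟨i, hi⟩ : ∃ i, z κ i ≠ z κ' i := by
      by_contra! hcon
      apply hne
      obtain ⟨j, b⟩ := κ
      obtain ⟨j', b'⟩ := κ'
      have hb : b = b' := by
        have := hcon ⟨0, hd⟩
        simp only [z] at this
        cases b <;> cases b' <;> simp at this ⊢ <;> omega
      subst hb
      congr 1
      funext i
      have := hcon i
      simp only [z] at this
      apply Fin.ext
      omega
    have h1 : (1 : ℝ) ≤ |(z κ i : ℝ) - z κ' i| := by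
      have : 1 ≤ |z κ i - z κ' i| := Int.one_le_abs (sub_ne_zero.2 hi)
      exact_mod_cast this
    rw [dist_add_left, dist_eq_norm]
    refine le_trans ?_ (PiLp.norm_apply_le (a κ - a κ') i)
    have e : (a κ - a κ') i = 2 * r * ((z κ i : ℝ) - z κ' i) := by simp [a]; ring
    rw [e, Real.norm_eq_abs, abs_mul, abs_of_pos (by positivity)]
    nlinarith
  · intro κ
    have hz : ∀ i, 0 ≤ (z κ i : ℝ) ∧ (z κ i : ℝ) ≤ 2 * n := by
      intro i
      have h1 : (κ.1 i : ℕ) < n := (κ.1 i).2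
      have h2 : 0 ≤ z κ i ∧ z κ i ≤ 2 * n := by
        simp only [z]; split_ifs <;> constructor <;> omega
      exact ⟨by exact_mod_cast h2.1, by exact_mod_cast h2.2⟩
    have hrn : r * n = R / (8 * d) := by rw [hr]; field_simp
    have hnorm : ‖a κ‖ ≤ R / 2 := by
      apply le_of_sq_le_sq _ (by positivity)
      rw [EuclideanSpace.norm_sq_eq]
      calc ∑ i, ‖a κ i‖ ^ 2 ≤ ∑ _i : Fin d, (R / (2 * d)) ^ 2 := by
            refine Finset.sum_le_sum fun i _ => ?_
            have e : a κ i = 2 * r * (z κ i : ℝ) := by simp [a]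
            rw [e, Real.norm_of_nonneg (mul_nonneg (by positivity) (hz i).1)]
            have : 2 * r * (z κ i : ℝ) ≤ R / (2 * d) := by
              calc 2 * r * (z κ i : ℝ) ≤ 2 * r * (2 * n) := by gcongr; exact (hz i).2
                _ = 4 * (r * n) := by ring
                _ = R / (2 * d) := by rw [hrn]; field_simp; norm_num
            exact pow_le_pow_left₀ (mul_nonneg (by positivity) (hz i).1) this 2
        _ = (R / 2) ^ 2 / d := by
            rw [Finset.sum_const, Finset.card_univ, Fintype.card_fin, nsmul_eq_mul]
            field_simp
        _ ≤ (R / 2) ^ 2 := div_le_self (by positivity) hd'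
    have hrR : r ≤ R / 8 := by
      rw [hr, div_div]
      apply div_le_div_of_nonneg_left hR.le (by norm_num)
      nlinarith
    refine Metric.closedBall_subset_ball' ?_
    rw [dist_self_add_left]
    linarith

/-- The minimax lower bound. -/
theorem exists_minimaxRisk_ge (hd : 1 ≤ d) {S : Set (EuclideanSpace ℝ (Fin d))} {CS : ℝ≥0}
    (hSb : Bornology.IsBounded S) (hS : MeasurableSet S) (hS0 : 0 < volume S)
    (hSC : μH[(d : ℝ) - 1] (frontier S) ≤ (CS : ℝ≥0∞)) :
    ∃ c : ℝ, 0 < c ∧ ∀ L M m : ℝ, 2 * (volume S).toReal⁻¹ ≤ L → 2 * (volume S).toReal⁻¹ ≤ M →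
      m ≤ (volume S).toReal⁻¹ / 2 → ∀ N : ℕ, 1 ≤ N →
        ENNReal.ofReal (c * (N : ℝ) ^ (-(1 / ((d : ℝ) + 2)))) ≤ minimaxRisk m M L CS S N := by
  have hSfin : volume S ≠ ∞ := hSb.measure_lt_top.ne
  have hv : 0 < (volume S).toReal⁻¹ := inv_pos.2 (ENNReal.toReal_pos hS0.ne' hSfin)
  set v := (volume S).toReal⁻¹ with hvdef
  have hκ := unitBallVolume_pos d
  have hd' : (1 : ℝ) ≤ d := by exact_mod_cast hd
  obtain ⟨x₀, R, hR0, hR1, hRS⟩ : ∃ (x₀ : EuclideanSpace ℝ (Fin d)) (R : ℝ), 0 < R ∧ R ≤ 1 ∧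
      Metric.ball x₀ R ⊆ S := by
    obtain ⟨x₀, hx₀⟩ := interior_nonempty_of_frontier hd hSC hS0
    obtain ⟨R, hR, hRS⟩ := Metric.isOpen_iff.1 isOpen_interior x₀ hx₀
    exact ⟨x₀, min R 1, by positivity, min_le_right _ _,
      (Metric.ball_subset_ball (min_le_left _ _)).trans (hRS.trans interior_subset)⟩
  set A := R / (8 * d) with hA
  have hA0 : 0 < A := by positivity
  have hA1 : A ≤ 1 / 2 := by
    rw [hA, div_le_iff₀ (by positivity)]; nlinarith
  -- `Q` is chosen so that `n ≥ Q N ^ (1/(d+2))` makes the total affinity loss over `N` samples at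
  -- most `1 / 2`; `Q ≥ 1` keeps rounding up within a factor `2`.
  set Q := 1 + 4 * unitBallVolume d * v * A ^ (d + 2) with hQ
  have hQ1 : 1 ≤ Q := by rw [hQ]; linarith [show 0 ≤ 4 * unitBallVolume d * v * A ^ (d + 2) by positivity]
  refine ⟨v * unitBallVolume d * A ^ d / (16 * 2 ^ d) * (A / (2 * Q)), by positivity, ?_⟩
  intro L M m hL hM hm N hN
  have hN' : (1 : ℝ) ≤ N := by exact_mod_cast hN
  set y := (N : ℝ) ^ (1 / ((d : ℝ) + 2)) with hy
  have hy1 : 1 ≤ y := Real.one_le_rpow hN' (by positivity)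
  have hyN : y ^ (d + 2) = N := by
    rw [hy, ← Real.rpow_natCast, ← Real.rpow_mul (by positivity)]
    push_cast
    rw [one_div_mul_cancel (by positivity), Real.rpow_one]
  set n := ⌈Q * y⌉₊ with hn
  have hQy : Q * y ≤ n := Nat.le_ceil _
  have hn1 : 1 ≤ n := Nat.one_le_ceil_iff.2 (by positivity)
  have hn2 : (n : ℝ) ≤ 2 * Q * y := by
    have : (n : ℝ) < Q * y + 1 := Nat.ceil_lt_add_one (by positivity)
    nlinarith
  have hn' : (1 : ℝ) ≤ n := by exact_mod_cast hn1
  have hr0 : 0 < A / n := by positivity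
  obtain ⟨c, hc, hcS⟩ := exists_separated_centers hd x₀ hR0 hn1
  rw [← hA] at hc hcS
  have hNr : N * (2 * unitBallVolume d * v * (A / n) ^ (d + 2)) ≤ 1 / 2 := by
    have h1 : Q * N ≤ (n : ℝ) ^ (d + 2) := by
      calc Q * N ≤ Q ^ (d + 2) * y ^ (d + 2) := by
            rw [hyN]
            gcongr
            exact le_self_pow₀ hQ1 (by omega)
        _ = (Q * y) ^ (d + 2) := (mul_pow _ _ _).symm
        _ ≤ _ := by gcongr
    rw [div_pow, ← mul_div_assoc, ← mul_div_assoc, div_le_iff₀ (by positivity)]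
    have h2 : 4 * unitBallVolume d * v * A ^ (d + 2) ≤ Q := by rw [hQ]; linarith
    nlinarith
  refine le_iInf₂ fun est hest => ?_
  have key := card_mul_le_worstRisk (m := m) (M := M) (L := L) hSb hS hS0.ne' hSC hm hM hL hr0
    ((div_le_self hA0.le hn').trans hA1) hc (fun κ => (hcS κ).trans hRS) hN hNr hest
  rw [← ENNReal.mul_le_mul_iff_right two_ne_zero (by norm_num : (2 : ℝ≥0∞) ≠ ∞)]
  refine le_trans ?_ key
  rw [← hvdef, Fintype.card_fun, Fintype.card_fin, Fintype.card_fin, ← ENNReal.ofReal_natCast,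
    ← ENNReal.ofReal_mul (by positivity), ← Nat.cast_two, ← ENNReal.ofReal_natCast 2,
    ← ENNReal.ofReal_mul (by positivity)]
  apply ENNReal.ofReal_le_ofReal
  rw [Real.rpow_neg (by positivity), ← hy]
  push_cast
  -- The number `n ^ d` of pairs cancels the volume of order `n ^ (-d)` of each ball, leaving the
  -- tent height `A / n`.
  have e : (n : ℝ) ^ d * (1 / 8 * (v * (A / n) * (unitBallVolume d * (A / n / 2) ^ d))) =
      2 * (v * unitBallVolume d * A ^ d / (16 * 2 ^ d) * (A / n)) := by
    rw [div_pow, div_pow]; field_simp; norm_num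
  rw [e]
  have h3 : A / (2 * Q) * y⁻¹ ≤ A / n := by
    rw [← div_eq_mul_inv, div_div]
    exact div_le_div_of_nonneg_left hA0.le (by positivity) hn2
  rw [mul_assoc (v * unitBallVolume d * A ^ d / (16 * 2 ^ d))]
  gcongr

/-- The two terms of the nearest-neighbour bound balance when `k` is of order
`N ^ (2 / (d + 2))`. -/
lemma rate_balance (hd : 1 ≤ d) {a b : ℝ} (ha : 0 < a) (hb : 0 ≤ b) {N k : ℕ} (hN : 1 ≤ N)
    (hka : a * (N : ℝ) ^ (2 / ((d : ℝ) + 2)) ≤ k)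
    (hkb : (k : ℝ) ≤ b * (N : ℝ) ^ (2 / ((d : ℝ) + 2))) :
    ((k : ℝ) / N) ^ (1 / (d : ℝ)) + (k : ℝ) ^ (-(1 / 2) : ℝ) ≤
      (b ^ (1 / (d : ℝ)) + a ^ (-(1 / 2) : ℝ)) * (N : ℝ) ^ (-(1 / ((d : ℝ) + 2))) := by
  have hd' : (1 : ℝ) ≤ d := by exact_mod_cast hd
  have hN' : (0 : ℝ) < N := by exact_mod_cast hN
  rw [add_mul]
  apply add_le_add
  · calc ((k : ℝ) / N) ^ (1 / (d : ℝ))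
        ≤ (b * (N : ℝ) ^ (-((d : ℝ) / (d + 2)))) ^ (1 / (d : ℝ)) := by
          refine Real.rpow_le_rpow (by positivity) ?_ (by positivity)
          rw [div_le_iff₀ hN', mul_assoc]
          refine hkb.trans (le_of_eq ?_)
          congr 1
          nth_rewrite 3 [← Real.rpow_one (N : ℝ)]
          rw [← Real.rpow_add hN']
          congr 1
          field_simp
          ring
      _ = _ := by
          rw [Real.mul_rpow hb (by positivity), ← Real.rpow_mul hN'.le]
          congr 2
          field_simp
  · calc (k : ℝ) ^ (-(1 / 2) : ℝ)
        ≤ (a * (N : ℝ) ^ (2 / ((d : ℝ) + 2))) ^ (-(1 / 2) : ℝ) :=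
          Real.rpow_le_rpow_of_nonpos (by positivity) hka (by norm_num)
      _ = _ := by
          rw [Real.mul_rpow ha.le (by positivity), ← Real.rpow_mul hN'.le]
          congr 2
          field_simp

end Rates

theorem theorem1 (d : ℕ) (hd : 1 ≤ d) :
    -- upper bound, with a constant that does not depend on `S`, `f`, `N`, `k`
    (∀ (m M L : ℝ) (CS : ℝ≥0), 0 < m →
      ∃ C : ℝ, 0 < C ∧
        ∀ (S : Set (EuclideanSpace ℝ (Fin d))) (f : EuclideanSpace ℝ (Fin d) → ℝ),
          IsBoundedSupportDensity d m M L CS S f →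
          ∀ N k : ℕ, 2 ≤ k → k ≤ N →
            l1Risk N S f (knnEstimator N k) ≤
              ENNReal.ofReal
                (C * (((k : ℝ) / N) ^ (1 / (d : ℝ)) + (k : ℝ) ^ (-(1 / 2) : ℝ)))) ∧
    -- minimax lower bound with known support, and optimality of kNN with `k ~ N ^ (2 / (d + 2))`
    (∀ (S : Set (EuclideanSpace ℝ (Fin d))) (CS : ℝ≥0),
      Bornology.IsBounded S → MeasurableSet S → 0 < volume S →
      μH[(d : ℝ) - 1] (frontier S) ≤ (CS : ℝ≥0∞) →
      ∃ L₀ M₀ m₀ c : ℝ, 0 < m₀ ∧ 0 < c ∧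
        ∀ L M m : ℝ, L₀ ≤ L → M₀ ≤ M → 0 < m → m ≤ m₀ →
          (∀ N : ℕ, 1 ≤ N →
            ENNReal.ofReal (c * (N : ℝ) ^ (-(1 / ((d : ℝ) + 2)))) ≤
              minimaxRisk m M L CS S N) ∧
          (∀ a b : ℝ, 0 < a → a ≤ b →
            ∃ C : ℝ, 0 < C ∧ ∀ N k : ℕ, 2 ≤ k → k ≤ N →
              a * (N : ℝ) ^ (2 / ((d : ℝ) + 2)) ≤ k →
              (k : ℝ) ≤ b * (N : ℝ) ^ (2 / ((d : ℝ) + 2)) →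
              worstRisk m M L CS S N (knnEstimator N k) ≤
                  ENNReal.ofReal (C * (N : ℝ) ^ (-(1 / ((d : ℝ) + 2)))) ∧
                worstRisk m M L CS S N (knnEstimator N k) ≤
                  ENNReal.ofReal C * minimaxRisk m M L CS S N)) := by
  refine ⟨exists_l1Risk_knnEstimator_le hd, ?_⟩
  intro S CS hSb hS hS0 hSC
  obtain ⟨c, hc, hlow⟩ := exists_minimaxRisk_ge hd hSb hS hS0 hSC
  have hv : 0 < (volume S).toReal⁻¹ :=
    inv_pos.2 (ENNReal.toReal_pos hS0.ne' hSb.measure_lt_top.ne)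
  refine ⟨2 * (volume S).toReal⁻¹, 2 * (volume S).toReal⁻¹, (volume S).toReal⁻¹ / 2, c,
    by positivity, hc, ?_⟩
  intro L M m hL hM hm hm0
  refine ⟨hlow L M m hL hM hm0, ?_⟩
  intro a b ha hab
  obtain ⟨C, hC, hup⟩ := exists_l1Risk_knnEstimator_le hd m M L CS hm
  have hb : 0 < b := ha.trans_le hab
  set C' := C * (b ^ (1 / (d : ℝ)) + a ^ (-(1 / 2) : ℝ)) with hC'
  have hC'0 : 0 < C' := by positivity
  -- `C'` serves the rate and `C' / c` the comparison with the minimax lower bound.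
  refine ⟨max C' (C' / c), lt_max_of_lt_left hC'0, ?_⟩
  intro N k hk2 hkN hka hkb
  have hN : 1 ≤ N := by omega
  have hx : 0 ≤ (N : ℝ) ^ (-(1 / ((d : ℝ) + 2))) := by positivity
  have h1 : worstRisk m M L CS S N (knnEstimator N k) ≤
      ENNReal.ofReal (C' * (N : ℝ) ^ (-(1 / ((d : ℝ) + 2)))) := by
    refine iSup₂_le fun f hf => (hup S f hf N k hk2 hkN).trans (ENNReal.ofReal_le_ofReal ?_)
    rw [hC', mul_assoc]
    exact mul_le_mul_of_nonneg_left (rate_balance hd ha hb.le hN hka hkb) hC.le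
  refine ⟨h1.trans (ENNReal.ofReal_le_ofReal (by gcongr; exact le_max_left _ _)), h1.trans ?_⟩
  calc ENNReal.ofReal (C' * (N : ℝ) ^ (-(1 / ((d : ℝ) + 2))))
      = ENNReal.ofReal (C' / c) * ENNReal.ofReal (c * (N : ℝ) ^ (-(1 / ((d : ℝ) + 2)))) := by
        rw [← ENNReal.ofReal_mul (by positivity)]
        congr 1
        field_simp
    _ ≤ _ := by
        gcongr
        · exact le_max_right _ _
        · exact hlow L M m hL hM hm0 N hN
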